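/- Let $(G,\sigma)$ be a planar signed graph, that is, a finite simple planar graph $G$ with a signature $\sigma:E(G)\to\{+1,-1\}$. Then $(G,\sigma)$ is $1$-defective signed $4$-choosable: for every list assignment $L$ that assigns to each vertex $v$ a finite set $L(v)\subseteq\mathbb{Z}$ with $|L(v)|\ge 4$, there is a map $c:V(G)\to\mathbb{Z}$ with $c(v)\in L(v)$ for every vertex $v$ such that, for every vertex $v$, \[ \bigl|\{u\in N(v) : c(u)=\sigma(uv)\,c(v)\}\bigr|\le 1 . \] -/

import Mathlib

/-- A rotation system of a graph `G`: at every vertex, a cyclic ordering of the darts (oriented edges)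
leaving that vertex. It is encoded as the permutation `rot` sending a dart to the next dart around
the same initial vertex; so its cycles are exactly the sets of all darts leaving a given vertex. -/
structure RotationSystem {V : Type*} (G : SimpleGraph V) where
  rot : Equiv.Perm G.Dart
  sameCycle_iff : ∀ d e : G.Dart, rot.SameCycle d e ↔ d.fst = e.fst

namespace RotationSystem

variable {V : Type*} {G : SimpleGraph V}

/-- Face tracing: traverse the dart `d`, turn around at its end, and take the next dart
in the cyclic order there. The cycles of this permutation are the facial walks. -/
def facePerm (R : RotationSystem G) : Equiv.Perm G.Dart :=
  (Function.Involutive.toPerm SimpleGraph.Dart.symm SimpleGraph.Dart.symm_involutive).trans R.rot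

/-- The number of faces, every connected component being drawn on its own sphere:
the facial walks, and one face for every isolated vertex (which has no darts). -/
noncomputable def faceCount (R : RotationSystem G) : ℕ :=
  Nat.card (Quotient (Equiv.Perm.SameCycle.setoid R.facePerm)) +
    Nat.card {v : V // ∀ w, ¬ G.Adj v w}

/-- The rotation system describes an embedding of each component of `G` in the sphere
(equivalently, in the plane): `V - E + F = 2 C`, with `C` the number of components.
Each component separately satisfies `V - E + F ≤ 2`, so the equality holds
exactly if every component has genus `0`. -/
def IsSpherical (R : RotationSystem G) : Prop :=
  Nat.card V + R.faceCount = Nat.card G.edgeSet + 2 * Nat.card G.ConnectedComponent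

end RotationSystem

/-- A finite graph is planar if it has a combinatorial embedding in the sphere (the plane). -/
def IsPlanarGraph {V : Type*} [Finite V] (G : SimpleGraph V) : Prop :=
  ∃ R : RotationSystem G, R.IsSpherical

/-- A signed graph: a simple graph with a sign `+1` or `-1` on every edge. -/
structure SignedGraph (V : Type*) where
  graph : SimpleGraph V
  sign : graph.edgeSet → ℤˣ

namespace SignedGraph

variable {V : Type*}

/-- A signed graph is planar if its underlying graph is. -/
def IsPlanar [Finite V] (S : SignedGraph V) : Prop :=
  IsPlanarGraph S.graph

/-- The neighbors `u` of `v` whose edge to `v` is violated by `c`, i.e. `c u = σ(uv) * c v`. -/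
def violations (S : SignedGraph V) (c : V → ℤ) (v : V) : Set V :=
  {u | ∃ h : S.graph.Adj u v,
    c u = ((S.sign ⟨s(u, v), (SimpleGraph.mem_edgeSet S.graph).mpr h⟩ : ℤˣ) : ℤ) * c v}

/-- `c` is `d`-defective: every vertex has at most `d` neighbors along violated edges. -/
def IsDefective [Finite V] (S : SignedGraph V) (d : ℕ) (c : V → ℤ) : Prop :=
  ∀ v, (S.violations c v).ncard ≤ d

/-- `d`-defective signed `k`-choosability: for all finite lists of at least `k` integers there is a
`d`-defective coloring from the lists. -/
def IsDefectiveChoosable [Finite V] (S : SignedGraph V) (d k : ℕ) : Prop :=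
  ∀ L : V → Finset ℤ, (∀ v, k ≤ (L v).card) →
    ∃ c : V → ℤ, (∀ v, c v ∈ L v) ∧ S.IsDefective d c

end SignedGraph

/-! Attach to an edge `uv` the linear form `X_u - σ(uv) X_v`, which vanishes at a colouring exactly
when the edge is violated. It suffices to find a matching `M` such that the product of the forms of
the edges outside `M` has a nonzero coefficient at a monomial with all exponents at most 3. The
Combinatorial Nullstellensatz then gives a colouring from lists of size 4 at which this product is
nonzero, so that every violated edge lies in `M` and each vertex meets at most one. Signs matter
little: the monomial is found for any nonzero edge coefficients `κ`.

Matching and monomial come from a Thomassen-type induction (`hasMonomial_of_noK5_of_noK33`). On a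
set `B` of boundary vertices, exponent plus matching degree is at most 2; on a set `R`, which is
empty, a vertex or an edge of the boundary, both vanish; elsewhere the exponent is at most 3,
matching edges not counted. A boundary vertex `v` next to `R` with at most one further boundary
neighbour is deleted (`HasMonomial.of_erase_boundary`). If its star cannot be absorbed directly, a
coefficient exchange yields another monomial of the smaller graph, and the edge from `v` to the
vertex whose exponent grew is put into the matching or charged to that vertex. If `v` has more
boundary neighbours, a chord through `v` separates the graph, and the two sides are glued
(`HasMonomial.glue`).

No drawing is used in the induction. The outer face is replaced by a connected set `S` of vertices
outside the current graph, and the boundary vertices are neighbours of `S`. The separating chord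
exists because otherwise there would be a `K₅` or `K₃,₃` minor (`exists_separator`). These minors
are excluded by linear algebra modulo 2: Euler's formula makes every even edge set a boundary of
faces (`RotationSystem.IsSpherical.exists_coboundary_eq`), and this duality passes to minors, where
`K₅` and `K₃,₃` have too many edges for their girth. -/

namespace SimpleGraph

/-! ### Incidence matrix modulo 2 and its rank -/

open scoped Classical in
/-- The incidence matrix modulo 2, with columns indexed by the edge set. -/
noncomputable def incidence {V : Type*} (G : SimpleGraph V) : Matrix V G.edgeSet (ZMod 2) :=
  Matrix.of fun v e => if v ∈ (e : Sym2 V) then 1 else 0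

/-- The edge of a dart, as an element of the edge set. -/
def Dart.edge' {V : Type*} {G : SimpleGraph V} (d : G.Dart) : G.edgeSet := ⟨d.edge, d.edge_mem⟩

section

variable {V : Type*} {G : SimpleGraph V}

theorem Dart.edge'_eq_iff (d e : G.Dart) : d.edge' = e.edge' ↔ d = e ∨ d = e.symm := by
  rw [← dart_edge_eq_iff, Dart.edge', Dart.edge', Subtype.mk.injEq]

theorem Dart.exists_edge'_eq (e : G.edgeSet) : ∃ d : G.Dart, d.edge' = e := by
  obtain ⟨e, he⟩ := e
  induction e with | _ u w => exact ⟨⟨(u, w), he⟩, rfl⟩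

theorem finite_dart [Finite V] : Finite G.Dart :=
  Finite.of_injective (fun d : G.Dart => d.toProd) Dart.toProd_injective

theorem incidence_transpose_mulVec [Fintype V] (g : V → ZMod 2) (d : G.Dart) :
    (G.incidence.transpose.mulVec g) d.edge' = g d.fst + g d.snd := by
  classical
  have h : ∀ v, (if v ∈ d.edge then (1 : ZMod 2) else 0) * g v =
      (if v = d.fst then g v else 0) + (if v = d.snd then g v else 0) := by
    intro v
    have hne := d.fst_ne_snd
    have hm : v ∈ d.edge ↔ v = d.fst ∨ v = d.snd := Sym2.mem_iff
    by_cases h1 : v = d.fst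
    · subst h1; simp [hm, hne]
    · by_cases h2 : v = d.snd
      · subst h2; simp [hm, h1]
      · simp [hm, h1, h2]
  simp only [Matrix.mulVec, dotProduct, Matrix.transpose_apply, incidence, Matrix.of_apply,
    Dart.edge']
  rw [Finset.sum_congr rfl fun v _ => h v]
  simp [Finset.sum_add_distrib]

open scoped Classical in
theorem incidence_mulVec [Fintype G.edgeSet] [Fintype G.Dart] (z : G.edgeSet → ZMod 2) (v : V) :
    (G.incidence.mulVec z) v = ∑ d : G.Dart with d.fst = v, z d.edge' := by
  have h1 : (G.incidence.mulVec z) v = ∑ e ∈ (Finset.univ : Finset G.edgeSet).filter (fun e : G.edgeSet => v ∈ e.1), z e := by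
    simp [Matrix.mulVec, dotProduct, incidence, Finset.sum_filter]
  rw [h1]
  symm
  refine Finset.sum_bij (fun d _ => d.edge') ?_ ?_ ?_ ?_
  · intro d hd
    rw [Finset.mem_filter] at hd ⊢
    exact ⟨Finset.mem_univ _, hd.2 ▸ Sym2.mem_mk_left _ _⟩
  · intro d hd e he h
    rw [Finset.mem_filter] at hd he
    rcases (Dart.edge'_eq_iff d e).1 h with h | h
    · exact h
    · exfalso
      have : e.snd = e.fst := by
        have := congrArg (fun d : G.Dart => d.fst) h
        exact this.symm.trans (hd.2.trans he.2.symm)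
      exact e.fst_ne_snd this.symm
  · rintro ⟨e, he⟩ hv
    rw [Finset.mem_filter] at hv
    obtain ⟨w, rfl⟩ := Sym2.mem_iff_exists.1 hv.2
    exact ⟨⟨(v, w), he⟩, by simp, rfl⟩
  · intro d _
    rfl

/-- A vector killed by the transpose agrees at the two ends of every edge, hence is constant on
components; so the corank is at most the number of components. -/
theorem card_sub_le_rank_incidence [Fintype V] [Fintype G.edgeSet] :
    Nat.card V ≤ G.incidence.rank + Nat.card G.ConnectedComponent := by
  classical
  have : Fintype G.ConnectedComponent := Fintype.ofFinite _
  have hker : G.incidence.transpose.mulVecLin.ker ≤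
      (LinearMap.funLeft (ZMod 2) (ZMod 2) G.connectedComponentMk).range := by
    intro g hg
    have hadj : ∀ u w, G.Adj u w → g u = g w := by
      intro u w h
      have h1 := incidence_transpose_mulVec g (⟨(u, w), h⟩ : G.Dart)
      rw [LinearMap.mem_ker, Matrix.mulVecLin_apply] at hg
      rw [hg] at h1
      exact CharTwo.add_eq_zero.1 h1.symm
    have hwalk : ∀ u w, G.Walk u w → g u = g w := by
      intro u w p
      induction p with
      | nil => rfl
      | cons h _ ih => exact (hadj _ _ h).trans ih
    exact ⟨ConnectedComponent.lift g fun u w p _ => hwalk u w p, rfl⟩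
  have h1 := Submodule.finrank_mono hker
  have h2 := LinearMap.finrank_range_le
    (LinearMap.funLeft (ZMod 2) (ZMod 2) G.connectedComponentMk)
  have h3 := LinearMap.finrank_range_add_finrank_ker G.incidence.transpose.mulVecLin
  rw [← Matrix.rank_transpose, Matrix.rank]
  rw [Module.finrank_fintype_fun_eq_card] at h2 h3
  rw [Nat.card_eq_fintype_card, Nat.card_eq_fintype_card]
  omega

end

end SimpleGraph

/-! ### Faces, their boundaries, and the discrete Jordan curve theorem -/

namespace RotationSystem

variable {V : Type*} {G : SimpleGraph V}

/-- The facial walks of a rotation system. -/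
abbrev Face (R : RotationSystem G) : Type _ :=
  Quotient (Equiv.Perm.SameCycle.setoid R.facePerm)

/-- The facial walk through a dart. -/
def face (R : RotationSystem G) (d : G.Dart) : R.Face := Quotient.mk _ d

theorem face_symm (R : RotationSystem G) (d : G.Dart) : R.face d.symm = R.face (R.rot d) := by
  refine Quotient.sound ?_
  change R.facePerm.SameCycle d.symm (R.rot d)
  have : R.facePerm d.symm = R.rot d := by
    change R.rot d.symm.symm = _
    rw [SimpleGraph.Dart.symm_symm]
  rw [← this]
  exact Equiv.Perm.sameCycle_apply_right.2 (Equiv.Perm.SameCycle.refl _ _)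

theorem rot_fst (R : RotationSystem G) (d : G.Dart) : (R.rot d).fst = d.fst :=
  ((R.sameCycle_iff d (R.rot d)).1 (Equiv.Perm.sameCycle_apply_right.2 (Equiv.Perm.SameCycle.refl _ _))).symm

/-- The set of edges on the boundary of a set of faces, modulo 2. -/
noncomputable def coboundary (R : RotationSystem G) :
    (R.Face → ZMod 2) →ₗ[ZMod 2] (G.edgeSet → ZMod 2) where
  toFun a e := a (R.face (SimpleGraph.Dart.exists_edge'_eq e).choose) +
    a (R.face (SimpleGraph.Dart.exists_edge'_eq e).choose.symm)
  map_add' a b := by ext e; simp only [Pi.add_apply]; ring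
  map_smul' c a := by ext e; simp only [Pi.smul_apply, smul_eq_mul, RingHom.id_apply]; ring

theorem coboundary_apply (R : RotationSystem G) (a : R.Face → ZMod 2) (d : G.Dart) :
    R.coboundary a d.edge' = a (R.face d) + a (R.face d.symm) := by
  have h := (SimpleGraph.Dart.exists_edge'_eq d.edge').choose_spec
  change a (R.face (SimpleGraph.Dart.exists_edge'_eq d.edge').choose) +
    a (R.face (SimpleGraph.Dart.exists_edge'_eq d.edge').choose.symm) = _
  rcases (SimpleGraph.Dart.edge'_eq_iff _ _).1 h with h | h
  · rw [h]
  · rw [h, SimpleGraph.Dart.symm_symm, add_comm]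

/-- At a vertex the face behind each dart is the face of the next dart in the rotation, so every
face value around the vertex is counted twice. -/
theorem incidence_coboundary [Fintype G.edgeSet] [Finite G.Dart] (R : RotationSystem G)
    (a : R.Face → ZMod 2) : G.incidence.mulVec (R.coboundary a) = 0 := by
  classical
  have : Fintype G.Dart := Fintype.ofFinite _
  ext v
  rw [SimpleGraph.incidence_mulVec]
  simp only [coboundary_apply, face_symm]
  rw [Finset.sum_add_distrib]
  have : ∑ d : G.Dart with d.fst = v, a (R.face (R.rot d)) =
      ∑ d : G.Dart with d.fst = v, a (R.face d) := by
    refine Finset.sum_bijective R.rot R.rot.bijective ?_ fun _ _ => rfl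
    intro d
    simp [rot_fst]
  rw [this]
  exact CharTwo.add_self_eq_zero _

/-- The coboundary map, with an additional face for every isolated vertex. -/
noncomputable def coboundary' (R : RotationSystem G) :
    (R.Face ⊕ {v : V // ∀ w, ¬ G.Adj v w} → ZMod 2) →ₗ[ZMod 2] (G.edgeSet → ZMod 2) :=
  R.coboundary.comp (LinearMap.funLeft (ZMod 2) (ZMod 2) Sum.inl)

/-- The connected component of a face. -/
def faceComponent (R : RotationSystem G) : R.Face → G.ConnectedComponent :=
  Quotient.lift (fun d => G.connectedComponentMk d.fst) (by
    intro d e h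
    obtain ⟨n, hn⟩ := (show R.facePerm.SameCycle d e from h)
    have step : ∀ d : G.Dart, G.connectedComponentMk (R.facePerm d).fst =
        G.connectedComponentMk d.fst := by
      intro d
      refine (SimpleGraph.ConnectedComponent.sound ?_)
      have : (R.facePerm d).fst = d.snd := R.rot_fst d.symm
      rw [this]
      exact d.adj.symm.reachable
    have hnat : ∀ (n : ℕ) (d : G.Dart), G.connectedComponentMk ((R.facePerm ^ n) d).fst =
        G.connectedComponentMk d.fst := by
      intro n
      induction n with
      | zero => intro d; rfl
      | succ n ih => intro d; rw [pow_succ', Equiv.Perm.mul_apply, step, ih]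
    obtain ⟨n, rfl | rfl⟩ := n.eq_nat_or_neg
    · rw [← hn, zpow_natCast, hnat]
    · rw [zpow_neg, zpow_natCast, Equiv.Perm.inv_eq_iff_eq] at hn
      rw [hn, hnat])

/-- A face function with zero boundary does not change across edges, hence not around a vertex,
hence not along a walk. The dummy faces of isolated vertices make the kernel dimension at most the
number of all components. -/
theorem ker_coboundary'_le (R : RotationSystem G) :
    R.coboundary'.ker ≤ (LinearMap.funLeft (ZMod 2) (ZMod 2)
      (Sum.elim R.faceComponent fun v : {v : V // ∀ w, ¬ G.Adj v w} =>
        G.connectedComponentMk v.1)).range := by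
  classical
  intro a ha
  have hface : ∀ d : G.Dart, a (Sum.inl (R.face d)) = a (Sum.inl (R.face d.symm)) := by
    intro d
    have h1 : R.coboundary' a d.edge' = 0 := by rw [LinearMap.mem_ker.1 ha]; rfl
    exact CharTwo.add_eq_zero.1 ((R.coboundary_apply (fun f => a (Sum.inl f)) d).symm.trans h1)
  have hrot : ∀ d : G.Dart, a (Sum.inl (R.face (R.rot d))) = a (Sum.inl (R.face d)) := by
    intro d
    rw [hface d, face_symm]
  have hvertex : ∀ d e : G.Dart, d.fst = e.fst →
      a (Sum.inl (R.face d)) = a (Sum.inl (R.face e)) := by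
    have hnat : ∀ (n : ℕ) (d : G.Dart),
        a (Sum.inl (R.face ((R.rot ^ n) d))) = a (Sum.inl (R.face d)) := by
      intro n
      induction n with
      | zero => intro d; rfl
      | succ n ih => intro d; rw [pow_succ', Equiv.Perm.mul_apply, hrot, ih]
    intro d e h
    obtain ⟨n, hn⟩ := (R.sameCycle_iff d e).2 h
    obtain ⟨n, rfl | rfl⟩ := n.eq_nat_or_neg
    · rw [← hn, zpow_natCast, hnat]
    · rw [zpow_neg, zpow_natCast, Equiv.Perm.inv_eq_iff_eq] at hn
      rw [hn, hnat]
  let g : V → ZMod 2 := fun v => if h : ∃ d : G.Dart, d.fst = v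
    then a (Sum.inl (R.face h.choose))
    else a (Sum.inr ⟨v, fun w hw => h ⟨⟨(v, w), hw⟩, rfl⟩⟩)
  have hg : ∀ d : G.Dart, g d.fst = a (Sum.inl (R.face d)) := by
    intro d
    have h : ∃ e : G.Dart, e.fst = d.fst := ⟨d, rfl⟩
    simp only [g, dif_pos h]
    exact hvertex _ _ h.choose_spec
  have hadj : ∀ u w, G.Adj u w → g u = g w := by
    intro u w h
    have h1 := hg ⟨(u, w), h⟩
    have h2 := hg (⟨(u, w), h⟩ : G.Dart).symm
    exact h1.trans ((hface _).trans h2.symm)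
  have hwalk : ∀ u w, G.Walk u w → g u = g w := by
    intro u w p
    induction p with
    | nil => rfl
    | cons h _ ih => exact (hadj _ _ h).trans ih
  refine ⟨SimpleGraph.ConnectedComponent.lift g fun u w p _ => hwalk u w p, ?_⟩
  ext x
  rcases x with f | ⟨v, hv⟩
  · induction f using Quotient.ind with | _ d => exact hg d
  · have h : ¬ ∃ d : G.Dart, d.fst = v := by
      rintro ⟨d, rfl⟩
      exact hv _ d.adj
    change g v = _
    simp only [g, dif_neg h]

/-- Discrete Jordan curve theorem: in a spherical rotation system every even set of edges is
the boundary of a set of faces. -/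
theorem IsSpherical.exists_coboundary_eq [Finite V] [Fintype G.edgeSet] {R : RotationSystem G}
    (hR : R.IsSpherical) (z : G.edgeSet → ZMod 2) (hz : G.incidence.mulVec z = 0) :
    ∃ a, R.coboundary a = z := by
  classical
  have : Fintype V := Fintype.ofFinite _
  have : Finite G.Dart := SimpleGraph.finite_dart
  have : Fintype R.Face := Fintype.ofFinite _
  have : Fintype {v : V // ∀ w, ¬ G.Adj v w} := Fintype.ofFinite _
  have : Fintype G.ConnectedComponent := Fintype.ofFinite _
  have hle : R.coboundary'.range ≤ G.incidence.mulVecLin.ker := by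
    rintro _ ⟨a, rfl⟩
    exact R.incidence_coboundary _
  have h1 := LinearMap.finrank_range_add_finrank_ker R.coboundary'
  have h2 := Submodule.finrank_mono R.ker_coboundary'_le
  have h3 := LinearMap.finrank_range_le (LinearMap.funLeft (ZMod 2) (ZMod 2)
      (Sum.elim R.faceComponent fun v : {v : V // ∀ w, ¬ G.Adj v w} =>
        G.connectedComponentMk v.1))
  have h4 := LinearMap.finrank_range_add_finrank_ker G.incidence.mulVecLin
  have h5 := SimpleGraph.card_sub_le_rank_incidence (G := G)
  have h6 := hR
  rw [IsSpherical, faceCount] at h6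
  change Nat.card V + (Nat.card R.Face + _) = _ at h6
  rw [Matrix.rank] at h5
  simp only [Module.finrank_fintype_fun_eq_card, Fintype.card_sum] at h1 h3 h4
  simp only [Nat.card_eq_fintype_card] at h5 h6
  -- The boundaries have dimension at least `F - C`, the even sets at most `E - V + C`; Euler's
  -- formula says that these bounds coincide.
  have heq := Submodule.eq_of_le_of_finrank_le hle (by omega)
  have hz' : z ∈ R.coboundary'.range := by rw [heq]; exact hz
  obtain ⟨a, ha⟩ := hz'
  exact ⟨_, ha⟩

end RotationSystem

/-! ### Euler counting and minors of spherical graphs -/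

/-- Counting: a graph with incidence matrix `N` and with girth at least `g` has no dual
multigraph (with edge ends `l`, `r`) when it has too many edges. -/
theorem Matrix.not_exists_dual {T I F : Type*} [Fintype T] [Fintype I] [Nonempty I] [Fintype F]
    (N : Matrix I T (ZMod 2)) (hN : ∀ e, ∑ i, N i e = 0) (l r : T → F) (g : ℕ)
    (h1 : ∀ y, N.mulVec y = 0 → ∃ a : F → ZMod 2, ∀ e, y e = a (l e) + a (r e))
    (h2 : ∀ a : F → ZMod 2, N.mulVec (fun e => a (l e) + a (r e)) = 0)
    (hg : ∀ y, N.mulVec y = 0 → y ≠ 0 → g ≤ (Finset.univ.filter fun e => y e ≠ 0).card)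
    (hI : Fintype.card I ≤ Fintype.card T)
    (hcard : 2 * Fintype.card T + g * Fintype.card I < g * (Fintype.card T + 2)) : False := by
  classical
  let Δ : (F → ZMod 2) →ₗ[ZMod 2] (T → ZMod 2) :=
    LinearMap.funLeft (ZMod 2) (ZMod 2) l + LinearMap.funLeft (ZMod 2) (ZMod 2) r
  have hΔ : ∀ a e, Δ a e = a (l e) + a (r e) := fun _ _ => rfl
  let s : F → T → ZMod 2 := fun φ => Δ (Pi.single φ 1)
  let Φ : Finset F := Finset.univ.filter fun φ => s φ ≠ 0
  -- the rank of `N`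
  let σ : (I → ZMod 2) →ₗ[ZMod 2] ZMod 2 := ∑ i, LinearMap.proj i
  have hσ : ∀ x, σ x = ∑ i, x i := fun x => by simp [σ]
  have hσs : Function.Surjective σ := by
    intro c
    obtain ⟨i⟩ := ‹Nonempty I›
    exact ⟨Pi.single i c, by simp [hσ]⟩
  -- Columns of `N` sum to zero, so the rank is at most `|I| - 1` and the cycle space has dimension
  -- at least `|T| - |I| + 1`.
  have hrank : N.mulVecLin.range ≤ σ.ker := by
    rintro _ ⟨y, rfl⟩
    rw [LinearMap.mem_ker, hσ]
    simp only [Matrix.mulVecLin_apply, Matrix.mulVec, dotProduct]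
    rw [Finset.sum_comm]
    simp [← Finset.sum_mul, hN]
  have e1 := Submodule.finrank_mono hrank
  have e2 := LinearMap.finrank_range_add_finrank_ker σ
  have e3 := LinearMap.finrank_range_add_finrank_ker N.mulVecLin
  rw [LinearMap.range_eq_top.2 hσs, finrank_top] at e2
  simp only [Module.finrank_fintype_fun_eq_card, Module.finrank_self] at e2 e3
  have e4 : N.mulVecLin.ker ≤ Δ.range := by
    intro y hy
    obtain ⟨a, ha⟩ := h1 y hy
    exact ⟨a, by ext e; rw [hΔ, ha]⟩
  have e5 := Submodule.finrank_mono e4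
  have hexp : ∀ a, Δ a = ∑ φ ∈ Φ, a φ • s φ := by
    intro a
    have : a = ∑ φ, a φ • (Pi.single φ 1 : F → ZMod 2) := by
      ext φ; simp [Finset.sum_apply, Pi.single_apply]
    conv_lhs => rw [this]
    rw [map_sum]
    simp only [map_smul]
    symm
    refine Finset.sum_subset (Finset.subset_univ _) ?_
    intro φ _ hφ
    have : s φ = 0 := by simpa [Φ] using hφ
    change a φ • s φ = 0
    rw [this, smul_zero]
  -- the number of faces
  have hcount : Φ.card * g ≤ 2 * Fintype.card T := by
    have k1 : Φ.card * g ≤ ∑ φ ∈ Φ, (Finset.univ.filter fun e => s φ e ≠ 0).card := by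
      rw [← smul_eq_mul]
      refine Finset.card_nsmul_le_sum _ _ _ ?_
      intro φ hφ
      exact hg _ (h2 (Pi.single φ 1)) (by simpa [Φ] using hφ)
    have k2 : ∑ φ ∈ Φ, (Finset.univ.filter fun e => s φ e ≠ 0).card =
        ∑ e : T, (Φ.filter fun φ => s φ e ≠ 0).card :=
      Finset.sum_card_bipartiteAbove_eq_sum_card_bipartiteBelow fun φ e => s φ e ≠ 0
    have k3 : ∀ e : T, (Φ.filter fun φ => s φ e ≠ 0).card ≤ 2 := by
      intro e
      refine (Finset.card_le_card (t := {l e, r e}) ?_).trans Finset.card_le_two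
      intro φ hφ
      by_contra hc
      rw [Finset.mem_insert, Finset.mem_singleton, not_or] at hc
      refine (Finset.mem_filter.1 hφ).2 ?_
      simp only [s, hΔ]
      rw [Pi.single_eq_of_ne (Ne.symm hc.1), Pi.single_eq_of_ne (Ne.symm hc.2), add_zero]
    calc Φ.card * g ≤ ∑ e : T, (Φ.filter fun φ => s φ e ≠ 0).card := k2 ▸ k1
      _ ≤ ∑ e : T, 2 := Finset.sum_le_sum fun e _ => k3 e
      _ = 2 * Fintype.card T := by simp [mul_comm]
  have hpos : 0 < Fintype.card I := Fintype.card_pos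
  -- All face boundaries add up to zero, so one of them can be left out of the spanning set.
  have hrange : Module.finrank (ZMod 2) Δ.range + 1 ≤ Φ.card ∨ Φ = ∅ := by
    rcases Φ.eq_empty_or_nonempty with h | ⟨φ₀, h₀⟩
    · exact Or.inr h
    refine Or.inl ?_
    have hsum : ∑ φ ∈ Φ, s φ = 0 := by
      have h := hexp fun _ => 1
      simp only [one_smul] at h
      rw [← h]
      ext e
      rw [hΔ]
      exact CharTwo.add_self_eq_zero _
    have hle : Δ.range ≤ Submodule.span (ZMod 2) (((Φ.erase φ₀).image s : Finset _) : Set (T → ZMod 2)) := by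
      rintro _ ⟨a, rfl⟩
      have : Δ a = ∑ φ ∈ Φ.erase φ₀, (a φ - a φ₀) • s φ := by
        have : ∑ φ ∈ Φ.erase φ₀, (a φ - a φ₀) • s φ = ∑ φ ∈ Φ, (a φ - a φ₀) • s φ := by
          rw [← Finset.add_sum_erase _ _ h₀, sub_self, zero_smul, zero_add]
        rw [this, hexp]
        simp only [sub_smul, Finset.sum_sub_distrib]
        rw [← Finset.smul_sum, hsum, smul_zero, sub_zero]
      rw [this]
      refine Submodule.sum_mem _ fun φ hφ => Submodule.smul_mem _ _ (Submodule.subset_span ?_)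
      exact Finset.mem_coe.2 (Finset.mem_image_of_mem _ hφ)
    have k1 := Submodule.finrank_mono hle
    have k2 := finrank_span_finset_le_card (R := ZMod 2) ((Φ.erase φ₀).image s)
    have k3 := Finset.card_image_le (s := Φ.erase φ₀) (f := s)
    have k4 := Finset.card_erase_add_one h₀
    rw [Set.finrank] at k2
    omega
  rcases hrange with h | h
  · have : Fintype.card T + 2 ≤ Φ.card + Fintype.card I := by omega
    have := Nat.mul_le_mul_left g this
    rw [mul_add, mul_add] at this
    rw [mul_add] at hcard
    rw [mul_comm] at hcount
    omega
  · have : Module.finrank (ZMod 2) Δ.range = 0 := by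
      have : Δ = 0 := by
        refine LinearMap.ext fun a => ?_
        rw [hexp, h, Finset.sum_empty, LinearMap.zero_apply]
      rw [this, LinearMap.range_zero, finrank_bot]
    omega

namespace SimpleGraph

variable {V : Type*} {G : SimpleGraph V}

/-- Connection by a path inside the set `A`. -/
def ConnIn (G : SimpleGraph V) (A : Set V) : V → V → Prop :=
  Relation.ReflTransGen fun p q => G.Adj p q ∧ p ∈ A ∧ q ∈ A

/-- The set `A` induces a connected (or empty) subgraph. -/
def IsConnSet (G : SimpleGraph V) (A : Set V) : Prop :=
  ∀ a ∈ A, ∀ b ∈ A, G.ConnIn A a b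

/-- There is an edge between `A` and `B`. -/
def Touch (G : SimpleGraph V) (A B : Set V) : Prop := ∃ a ∈ A, ∃ b ∈ B, G.Adj a b

open scoped Classical in
theorem incidence_single [Fintype G.edgeSet] (d : G.Dart) :
    G.incidence.mulVec (Pi.single d.edge' 1) = Pi.single d.fst 1 + Pi.single d.snd 1 := by
  ext v
  have hne := d.fst_ne_snd
  have hm : v ∈ (d.edge' : Sym2 V) ↔ v = d.fst ∨ v = d.snd := Sym2.mem_iff
  rw [Matrix.mulVec_single_one]
  simp only [Matrix.col_apply, incidence, Matrix.of_apply, hm, Pi.add_apply, Pi.single_apply]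
  by_cases h1 : v = d.fst
  · subst h1; simp [hne]
  · by_cases h2 : v = d.snd
    · simp [h2, Ne.symm hne]
    · simp [h1, h2]

open scoped Classical in
theorem ConnIn.exists_edges [Fintype G.edgeSet] {A : Set V} {a b : V} (h : G.ConnIn A a b) :
    ∃ z : G.edgeSet → ZMod 2, G.incidence.mulVec z = Pi.single a 1 + Pi.single b 1 ∧
      ∀ d : G.Dart, z d.edge' ≠ 0 → d.fst ∈ A ∧ d.snd ∈ A := by
  induction h with
  | refl =>
    refine ⟨0, ?_, fun d h => absurd rfl h⟩
    rw [Matrix.mulVec_zero]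
    exact funext fun _ => (CharTwo.add_self_eq_zero _).symm
  | @tail p q _ hpq ih =>
    obtain ⟨z, h1, h2⟩ := ih
    let d₀ : G.Dart := ⟨(p, q), hpq.1⟩
    refine ⟨z + Pi.single d₀.edge' 1, ?_, ?_⟩
    · rw [Matrix.mulVec_add, h1, incidence_single]
      change _ + (Pi.single p 1 + Pi.single q 1) = _
      have : (Pi.single p 1 + Pi.single p 1 : V → ZMod 2) = 0 :=
        funext fun _ => CharTwo.add_self_eq_zero _
      rw [add_assoc, ← add_assoc (Pi.single p 1), this, zero_add]
    · intro d hd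
      by_cases h : d.edge' = d₀.edge'
      · rcases (Dart.edge'_eq_iff _ _).1 h with rfl | rfl
        · exact hpq.2
        · exact hpq.2.symm
      · refine h2 d ?_
        rwa [Pi.add_apply, Pi.single_eq_of_ne h, add_zero] at hd

end SimpleGraph

open SimpleGraph in
/-- A spherical graph has no model of a graph with girth at least `g` and many edges. -/
theorem RotationSystem.IsSpherical.not_exists_model {V : Type*} [Finite V] {G : SimpleGraph V}
    {R : RotationSystem G} (hR : R.IsSpherical) {T I : Type*} [Fintype T] [Fintype I] [Nonempty I]
    [DecidableEq I] (s t : T → I) (hst : ∀ e, s e ≠ t e)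
    (hinj : ∀ e e', (s e = s e' ∧ t e = t e') ∨ (s e = t e' ∧ t e = s e') → e = e') (g : ℕ)
    (hg : ∀ y : T → ZMod 2, (∀ i, ∑ e, ((if s e = i then 1 else 0) + (if t e = i then 1 else 0)) * y e = 0) →
      y ≠ 0 → g ≤ (Finset.univ.filter fun e => y e ≠ 0).card)
    (hI : Fintype.card I ≤ Fintype.card T)
    (hcard : 2 * Fintype.card T + g * Fintype.card I < g * (Fintype.card T + 2))
    (β : I → Set V) (hdisj : ∀ i j v, v ∈ β i → v ∈ β j → i = j) (hconn : ∀ i, G.IsConnSet (β i))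
    (hne : ∀ i, (β i).Nonempty)
    (hf : ∀ e, G.Touch (β (s e)) (β (t e))) : False := by
  classical
  have : Fintype V := Fintype.ofFinite _
  have : Finite G.Dart := finite_dart
  have : Fintype G.edgeSet := Fintype.ofFinite _
  have : Fintype R.Face := Fintype.ofFinite _
  have hd : ∀ e, ∃ d : G.Dart, d.fst ∈ β (s e) ∧ d.snd ∈ β (t e) := by
    intro e
    obtain ⟨a, ha, b, hb, hab⟩ := hf e
    exact ⟨⟨(a, b), hab⟩, ha, hb⟩
  choose f hfs hft using hd
  choose ρ hρ using hne
  have hfinj : ∀ e e', (f e).edge' = (f e').edge' → e = e' := by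
    intro e e' h
    refine hinj e e' ?_
    rcases (Dart.edge'_eq_iff _ _).1 h with h | h
    · exact Or.inl ⟨hdisj _ _ _ (hfs e) (h ▸ hfs e'), hdisj _ _ _ (hft e) (h ▸ hft e')⟩
    · exact Or.inr ⟨hdisj _ _ _ (hfs e) (h ▸ hft e'), hdisj _ _ _ (hft e) (h ▸ hfs e')⟩
  have hfout : ∀ e i, ¬ ((f e).fst ∈ β i ∧ (f e).snd ∈ β i) := by
    intro e i h
    exact hst e ((hdisj _ _ _ (hfs e) h.1).trans (hdisj _ _ _ h.2 (hft e)))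
  -- the edges of the model
  let X : G.edgeSet → Prop := fun x => (∃ e, (f e).edge' = x) ∨
    ∃ (d : G.Dart) (i : I), d.edge' = x ∧ d.fst ∈ β i ∧ d.snd ∈ β i
  -- lifting of cycles
  have hpath : ∀ e, ∃ z : G.edgeSet → ZMod 2,
      G.incidence.mulVec z = Pi.single (ρ (s e)) 1 + Pi.single (ρ (t e)) 1 ∧
      (∀ e', z (f e').edge' = if e' = e then 1 else 0) ∧ ∀ x, z x ≠ 0 → X x := by
    intro e
    obtain ⟨z₁, h₁, k₁⟩ := (hconn _ _ (hρ (s e)) _ (hfs e)).exists_edges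
    obtain ⟨z₂, h₂, k₂⟩ := (hconn _ _ (hft e) _ (hρ (t e))).exists_edges
    refine ⟨z₁ + Pi.single (f e).edge' 1 + z₂, ?_, ?_, ?_⟩
    · rw [Matrix.mulVec_add, Matrix.mulVec_add, h₁, h₂, incidence_single]
      have h : ∀ v : V, (Pi.single v 1 + Pi.single v 1 : V → ZMod 2) = 0 :=
        fun v => funext fun _ => CharTwo.add_self_eq_zero _
      calc _ = Pi.single (ρ (s e)) 1 + (Pi.single (f e).fst 1 + Pi.single (f e).fst 1) +
          (Pi.single (f e).snd 1 + Pi.single (f e).snd 1) + Pi.single (ρ (t e)) 1 := by abel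
        _ = _ := by rw [h, h, add_zero, add_zero]
    · intro e'
      have a1 : z₁ (f e').edge' = 0 := by_contra fun h => hfout _ _ (k₁ _ h)
      have a2 : z₂ (f e').edge' = 0 := by_contra fun h => hfout _ _ (k₂ _ h)
      rw [Pi.add_apply, Pi.add_apply, a1, a2, zero_add, add_zero, Pi.single_apply]
      refine if_congr ⟨hfinj _ _, fun h => h ▸ rfl⟩ rfl rfl
    · intro x hx
      by_cases h : x = (f e).edge'
      · exact Or.inl ⟨e, h.symm⟩
      rw [Pi.add_apply, Pi.add_apply, Pi.single_eq_of_ne h, add_zero] at hx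
      obtain ⟨d, rfl⟩ := Dart.exists_edge'_eq x
      by_cases h1 : z₁ d.edge' = 0
      · rw [h1, zero_add] at hx
        exact Or.inr ⟨d, _, rfl, k₂ d hx⟩
      · exact Or.inr ⟨d, _, rfl, k₁ d h1⟩
  choose P hP1 hP2 hP3 using hpath
  let N : Matrix I T (ZMod 2) := Matrix.of fun i e => (if s e = i then 1 else 0) + (if t e = i then 1 else 0)
  have hlift : ∀ y, N.mulVec y = 0 → ∃ z, G.incidence.mulVec z = 0 ∧
      (∀ e, z (f e).edge' = y e) ∧ ∀ x, z x ≠ 0 → X x := by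
    intro y hy
    refine ⟨∑ e, y e • P e, ?_, ?_, ?_⟩
    · rw [Matrix.mulVec_sum]
      simp only [Matrix.mulVec_smul, hP1]
      have hx : ∀ i, ∑ e, y e * N i e = 0 := by
        intro i
        have := congrFun hy i
        simp only [Matrix.mulVec, dotProduct, Pi.zero_apply] at this
        simpa only [mul_comm] using this
      have : ∑ e, y e • (Pi.single (ρ (s e)) 1 + Pi.single (ρ (t e)) 1 : V → ZMod 2) =
          ∑ i, (∑ e, y e * N i e) • (Pi.single (ρ i) 1 : V → ZMod 2) := by
        simp only [Finset.sum_smul]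
        rw [Finset.sum_comm]
        refine Finset.sum_congr rfl fun e _ => ?_
        simp only [N, Matrix.of_apply, mul_smul, ← Finset.smul_sum, add_smul,
          Finset.sum_add_distrib, ite_smul, one_smul, zero_smul, Finset.sum_ite_eq,
          Finset.mem_univ, if_true]
      rw [this]
      simp [hx]
    · intro e
      simp [Finset.sum_apply, hP2]
    · intro x hx
      by_contra hX
      refine hx ?_
      rw [Finset.sum_apply]
      refine Finset.sum_eq_zero fun e _ => ?_
      rw [Pi.smul_apply, by_contra fun h => hX (hP3 e x h), smul_zero]
  -- the faces of the model
  let rel : R.Face → R.Face → Prop := fun φ ψ => ∃ d : G.Dart, ¬ X d.edge' ∧ φ = R.face d ∧ ψ = R.face d.symm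
  have : Fintype (Quot rel) := Fintype.ofFinite _
  refine Matrix.not_exists_dual N ?_ (fun e => Quot.mk rel (R.face (f e)))
    (fun e => Quot.mk rel (R.face (f e).symm)) g ?_ ?_ ?_ hI hcard
  · intro e
    simp only [N, Matrix.of_apply, Finset.sum_add_distrib]
    simp only [Finset.sum_ite_eq, Finset.mem_univ, if_true]
    exact CharTwo.add_self_eq_zero _
  · intro y hy
    obtain ⟨z, h1, h2, h3⟩ := hlift y hy
    obtain ⟨a, rfl⟩ := hR.exists_coboundary_eq z h1
    refine ⟨Quot.lift a ?_, ?_⟩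
    · rintro _ _ ⟨d, hd, rfl, rfl⟩
      have : R.coboundary a d.edge' = 0 := by_contra fun h => hd (h3 _ h)
      rw [coboundary_apply] at this
      exact CharTwo.add_eq_zero.1 this
    · intro e
      rw [← h2, coboundary_apply]
  · intro a
    have h1 := R.incidence_coboundary fun φ => a (Quot.mk rel φ)
    set z := R.coboundary fun φ => a (Quot.mk rel φ) with hz
    have hzX : ∀ x, ¬ X x → z x = 0 := by
      intro x hx
      obtain ⟨d, rfl⟩ := Dart.exists_edge'_eq x
      rw [hz, coboundary_apply]
      have : Quot.mk rel (R.face d) = Quot.mk rel (R.face d.symm) := Quot.sound ⟨d, hx, rfl, rfl⟩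
      rw [this]
      exact CharTwo.add_self_eq_zero _
    ext i
    -- Summing the vertex conditions over a branch set cancels its inner edges and leaves the
    -- condition at the contracted vertex.
    let χ : V → ZMod 2 := fun v => if v ∈ β i then 1 else 0
    have hχ : ∀ j v, v ∈ β j → χ v = if j = i then 1 else 0 := by
      intro j v hv
      exact if_congr ⟨fun h => hdisj _ _ _ hv h, fun h => h ▸ hv⟩ rfl rfl
    have h2 : ∑ x, (G.incidence.transpose.mulVec χ) x * z x = 0 := by
      have : (G.incidence.transpose.mulVec χ) ⬝ᵥ z = 0 := by
        rw [Matrix.mulVec_transpose, ← Matrix.dotProduct_mulVec, h1, dotProduct_zero]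
      exact this
    have h3 : ∑ e, (G.incidence.transpose.mulVec χ) (f e).edge' * z (f e).edge' = 0 := by
      rw [← h2, ← Finset.sum_image (s := Finset.univ) (g := fun e => (f e).edge')
        (f := fun x => (G.incidence.transpose.mulVec χ) x * z x) fun e _ e' _ h => hfinj e e' h]
      refine Finset.sum_subset (Finset.subset_univ _) ?_
      intro x _ hx
      by_cases hX : X x
      · rcases hX with ⟨e, rfl⟩ | ⟨d, j, rfl, h4, h5⟩
        · exact absurd (Finset.mem_image_of_mem _ (Finset.mem_univ e)) hx
        · rw [incidence_transpose_mulVec, hχ _ _ h4, hχ _ _ h5, CharTwo.add_self_eq_zero, zero_mul]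
      · rw [hzX x hX, mul_zero]
    simp only [incidence_transpose_mulVec, hχ _ _ (hfs _), hχ _ _ (hft _)] at h3
    simp only [Matrix.mulVec, dotProduct, N, Matrix.of_apply, Pi.zero_apply]
    refine Eq.trans ?_ h3
    refine Finset.sum_congr rfl fun e _ => ?_
    rw [hz, coboundary_apply]
  · intro y hy
    exact hg y fun i => congrFun hy i

/-- By parity, an even edge set cannot meet a vertex in a single edge. -/
theorem exists_other_edge {T I : Type*} [Fintype T] [DecidableEq I] {s t : T → I}
    (hst : ∀ e, s e ≠ t e) {y : T → ZMod 2}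
    (hy : ∀ i, ∑ e, ((if s e = i then 1 else 0) + (if t e = i then 1 else 0)) * y e = 0)
    {e : T} (he : y e ≠ 0) {i : I} (hi : s e = i ∨ t e = i) :
    ∃ e', e' ≠ e ∧ y e' ≠ 0 ∧ (s e' = i ∨ t e' = i) := by
  classical
  by_contra! hc
  have h := hy i
  rw [Finset.sum_eq_single e] at h
  · have h1 : ((if s e = i then 1 else 0) + (if t e = i then 1 else 0) : ZMod 2) = 1 := by
      rcases hi with rfl | rfl
      · simp [(hst e).symm]
      · simp [hst e]
    rw [h1, one_mul] at h
    exact he h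
  · intro e' _ hne
    by_cases h0 : y e' = 0
    · rw [h0, mul_zero]
    · obtain ⟨h1, h2⟩ := hc e' hne h0
      simp [h1, h2]
  · intro h
    exact absurd (Finset.mem_univ _) h

/-! ### Spherical graphs have no `K₅` or `K₃,₃` minor -/

namespace SimpleGraph

variable {V : Type*} (G : SimpleGraph V)

/-- The graph has no `K₅` minor. -/
def NoK5 : Prop := ∀ β : Fin 5 → Set V, (∀ i j v, v ∈ β i → v ∈ β j → i = j) →
  (∀ i, G.IsConnSet (β i)) → ¬ ∀ i j, i < j → G.Touch (β i) (β j)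

/-- The graph has no `K₃,₃` minor. -/
def NoK33 : Prop := ∀ β : Fin 3 ⊕ Fin 3 → Set V, (∀ i j v, v ∈ β i → v ∈ β j → i = j) →
  (∀ i, G.IsConnSet (β i)) → ¬ ∀ i j, G.Touch (β (Sum.inl i)) (β (Sum.inr j))

variable {G}

/-- The count with 10 edges, 5 vertices and girth 3 is violated: `20 + 15 < 36`. The girth bound
follows by continuing an edge of an even set at both ends. -/
theorem _root_.RotationSystem.IsSpherical.noK5 [Finite V] {R : RotationSystem G}
    (hR : R.IsSpherical) : G.NoK5 := by
  classical
  intro β hdisj hconn ht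
  refine hR.not_exists_model (T := {p : Fin 5 × Fin 5 // p.1 < p.2}) (I := Fin 5) (fun p => p.1.1)
    (fun p => p.1.2) (fun p => p.2.ne) ?_ 3 ?_ (by decide) (by decide) β hdisj hconn ?_
    fun p => ht _ _ p.2
  · rintro ⟨⟨a, b⟩, h⟩ ⟨⟨c, d⟩, h'⟩ (⟨h1, h2⟩ | ⟨h1, h2⟩)
    · exact Subtype.ext (Prod.ext h1 h2)
    · exact absurd (h1 ▸ h2 ▸ h) (not_lt.2 h'.le)
  · intro y hy h0
    obtain ⟨e, he⟩ := Function.ne_iff.1 h0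
    have hst : ∀ p : {p : Fin 5 × Fin 5 // p.1 < p.2}, p.1.1 ≠ p.1.2 := fun p => p.2.ne
    obtain ⟨e₁, n1, y1, i1⟩ := exists_other_edge hst hy he (Or.inl rfl)
    obtain ⟨e₂, n2, y2, i2⟩ := exists_other_edge hst hy he (Or.inr rfl)
    have n12 : e₁ ≠ e₂ := by
      rintro rfl
      obtain ⟨⟨a, b⟩, h⟩ := e
      obtain ⟨⟨c, d⟩, h'⟩ := e₁
      simp only [ne_eq, Subtype.mk.injEq, Prod.mk.injEq] at n1 i1 i2 h h'
      rcases i1 with i1 | i1 <;> rcases i2 with i2 | i2 <;> subst i1 <;> subst i2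
      · exact absurd h (lt_irrefl _)
      · exact n1 ⟨rfl, rfl⟩
      · exact absurd h (not_lt.2 h'.le)
      · exact absurd h (lt_irrefl _)
    rw [← Finset.card_eq_three.2 ⟨e, e₁, e₂, n1.symm, n2.symm, n12, rfl⟩]
    refine Finset.card_le_card ?_
    intro x hx
    simp only [Finset.mem_insert, Finset.mem_singleton] at hx
    rcases hx with rfl | rfl | rfl <;> simpa
  · intro i
    by_cases h : i < 4
    · obtain ⟨a, ha, -⟩ := ht i 4 h
      exact ⟨a, ha⟩
    · obtain ⟨-, -, a, ha, -⟩ := ht 0 i (by omega)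
      exact ⟨a, ha⟩

/-- Here 9 edges, 6 vertices and girth 4 give `18 + 24 < 44`. A fourth edge of an even set is
obtained by extending the path at one end once more; bipartiteness keeps it distinct from the
others. -/
theorem _root_.RotationSystem.IsSpherical.noK33 [Finite V] {R : RotationSystem G}
    (hR : R.IsSpherical) : G.NoK33 := by
  classical
  intro β hdisj hconn ht
  refine hR.not_exists_model (T := Fin 3 × Fin 3) (I := Fin 3 ⊕ Fin 3) (fun p => Sum.inl p.1)
    (fun p => Sum.inr p.2) (fun p => Sum.inl_ne_inr) ?_ 4 ?_ (by decide) (by decide) β hdisj hconn ?_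
    fun p => ht _ _
  · rintro ⟨a, b⟩ ⟨c, d⟩ (⟨h1, h2⟩ | ⟨h1, h2⟩)
    · exact Prod.ext (Sum.inl.inj h1) (Sum.inr.inj h2)
    · exact absurd h1 Sum.inl_ne_inr
  · intro y hy h0
    obtain ⟨e, he⟩ := Function.ne_iff.1 h0
    have hst : ∀ p : Fin 3 × Fin 3, (Sum.inl p.1 : Fin 3 ⊕ Fin 3) ≠ Sum.inr p.2 :=
      fun p => Sum.inl_ne_inr
    obtain ⟨e₁, n1, y1, i1⟩ := exists_other_edge hst hy he (Or.inl rfl)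
    obtain ⟨e₂, n2, y2, i2⟩ := exists_other_edge hst hy he (Or.inr rfl)
    obtain ⟨e₃, n3, y3, i3⟩ := exists_other_edge hst hy y1 (Or.inr rfl)
    obtain ⟨a, b⟩ := e
    obtain ⟨a₁, b₁⟩ := e₁
    obtain ⟨a₂, b₂⟩ := e₂
    obtain ⟨a₃, b₃⟩ := e₃
    simp only [ne_eq, Prod.mk.injEq, Sum.inl.injEq, Sum.inr.injEq, reduceCtorEq, or_false, false_or]
      at n1 n2 n3 i1 i2 i3
    have hsub : ({(a, b), (a₁, b₁), (a₂, b₂), (a₃, b₃)} : Finset (Fin 3 × Fin 3)) ⊆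
        Finset.univ.filter fun e => y e ≠ 0 := by
      intro x hx
      simp only [Finset.mem_insert, Finset.mem_singleton] at hx
      rcases hx with rfl | rfl | rfl | rfl <;> simpa
    refine le_trans ?_ (Finset.card_le_card hsub)
    rw [Finset.card_insert_of_notMem, Finset.card_insert_of_notMem, Finset.card_insert_of_notMem,
      Finset.card_singleton]
    all_goals
      simp only [Finset.mem_insert, Finset.mem_singleton, Prod.mk.injEq]
      omega
  · rintro (i | i)
    · obtain ⟨a, ha, -⟩ := ht i 0
      exact ⟨a, ha⟩
    · obtain ⟨-, -, a, ha, -⟩ := ht 0 i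
      exact ⟨a, ha⟩

/-! ### Connectivity inside a set, and separation from the excluded minors -/

theorem ConnIn.symm {A : Set V} {a b : V} (h : G.ConnIn A a b) : G.ConnIn A b a :=
  by
    induction h with
    | refl => exact Relation.ReflTransGen.refl
    | tail _ h ih => exact Relation.ReflTransGen.head ⟨h.1.symm, h.2.2, h.2.1⟩ ih

theorem ConnIn.mono {A B : Set V} (hAB : A ⊆ B) {a b : V} (h : G.ConnIn A a b) : G.ConnIn B a b :=
  Relation.ReflTransGen.mono (fun _ _ h => ⟨h.1, hAB h.2.1, hAB h.2.2⟩) _ _ h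

theorem ConnIn.mem {A : Set V} {a b : V} (h : G.ConnIn A a b) (ha : a ∈ A) : b ∈ A := by
  cases h with
  | refl => exact ha
  | tail _ h => exact h.2.2

theorem ConnIn.exists_exit {A C : Set V} {a b : V} (h : G.ConnIn A a b) (ha : a ∈ C) (hb : b ∉ C) :
    ∃ p q, G.Adj p q ∧ p ∈ A ∧ q ∈ A ∧ p ∈ C ∧ q ∉ C := by
  induction h with
  | refl => exact absurd ha hb
  | @tail p q _ hpq ih =>
    by_cases hp : p ∈ C
    · exact ⟨p, q, hpq.1, hpq.2.1, hpq.2.2, hp, hb⟩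
    · exact ih hp

theorem isConnSet_connIn (A : Set V) (a : V) : G.IsConnSet {b | G.ConnIn A a b} := by
  have h : ∀ b, G.ConnIn A a b → G.ConnIn {b | G.ConnIn A a b} a b := by
    intro b hb
    induction hb with
    | refl => exact Relation.ReflTransGen.refl
    | tail hp hpq ih => exact ih.tail ⟨hpq.1, hp, hp.tail hpq⟩
  intro b hb c hc
  exact (h b hb).symm.trans (h c hc)

theorem isConnSet_singleton (a : V) : G.IsConnSet {a} := by
  rintro _ rfl _ rfl
  exact Relation.ReflTransGen.refl

theorem IsConnSet.insert {S : Set V} (hS : G.IsConnSet S) {v u : V} (hu : u ∈ S) (h : G.Adj v u) :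
    G.IsConnSet (insert v S) := by
  have key : ∀ a ∈ Insert.insert v S, G.ConnIn (Insert.insert v S) a u := by
    rintro a (rfl | ha)
    · exact Relation.ReflTransGen.single ⟨h, Or.inl rfl, Or.inr hu⟩
    · exact (hS a ha u hu).mono (Set.subset_insert _ _)
  intro a ha b hb
  exact (key a ha).trans (key b hb).symm

theorem Touch.symm {A B : Set V} (h : G.Touch A B) : G.Touch B A := by
  obtain ⟨a, ha, b, hb, hab⟩ := h
  exact ⟨b, hb, a, ha, hab.symm⟩

/-- A vertex of a connected set touches the component of any other vertex after its deletion. -/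
theorem ConnIn.touch {P : Set V} {a b p : V} (h : G.ConnIn P a b) (ha : a ∈ P) (hap : a ≠ p)
    (hb : ¬ G.ConnIn (P \ {p}) a b) : G.Touch {p} {q | G.ConnIn (P \ {p}) a q} := by
  obtain ⟨q, r, hqr, hq, hr, hqC, hrC⟩ :=
    h.exists_exit (C := {q | G.ConnIn (P \ {p}) a q}) Relation.ReflTransGen.refl hb
  have hrp : r = p := by
    by_contra hne
    exact hrC (Relation.ReflTransGen.tail hqC ⟨hqr, ConnIn.mem hqC ⟨ha, hap⟩, hr, hne⟩)
  exact ⟨p, rfl, q, hqC, hrp ▸ hqr.symm⟩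

/-- If two connected sets `S` and `{v}` both touch three vertices outside, then in the rest of
the graph one of these vertices separates the other two. -/
theorem exists_separator [Finite V] (h5 : G.NoK5) (h33 : G.NoK33) {S A : Set V} {v x w w' : V}
    (hS : G.IsConnSet S) (hSA : ∀ u ∈ S, u ∉ A) (hvA : v ∉ A) (hvS : v ∉ S)
    (hxA : x ∈ A) (hwA : w ∈ A) (hwA' : w' ∈ A) (hxw : x ≠ w) (hxw' : x ≠ w') (hww' : w ≠ w')
    (hv : G.Adj v x) (hvw : G.Adj v w) (hvw' : G.Adj v w')
    (sv : G.Touch S {v}) (sx : G.Touch S {x}) (sw : G.Touch S {w}) (sw' : G.Touch S {w'})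
    (c1 : G.ConnIn (A \ {w'}) x w) (c2 : G.ConnIn (A \ {w}) w' x) (c3 : G.ConnIn (A \ {x}) w' w) :
    False := by
  have mono : ∀ {B C D : Set V}, C ⊆ D → G.Touch B C → G.Touch B D := by
    rintro B C D h ⟨a, ha, b, hb, hab⟩
    exact ⟨a, ha, b, h hb, hab⟩
  -- a minimal connection between `x` and `w`
  obtain ⟨P, hPmin⟩ := (Set.toFinite {P : Set V | P ⊆ A \ {w'} ∧ x ∈ P ∧ w ∈ P ∧
    G.ConnIn P x w}).exists_minimal ⟨A \ {w'}, subset_rfl, ⟨hxA, hxw'⟩, ⟨hwA, hww'⟩, c1⟩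
  obtain ⟨hPA, hxP, hwP, hPc⟩ := hPmin.prop
  have hw'P : w' ∉ P := fun h => (hPA h).2 rfl
  have hPsub : ∀ p ∈ P, p ∈ A := fun p hp => (hPA hp).1
  -- By minimality every inner vertex of `P` separates `x` from `w` within `P`.
  have hPcut : ∀ p ∈ P, p ≠ x → p ≠ w → ¬ G.ConnIn (P \ {p}) x w := by
    intro p hp hpx hpw h
    have := hPmin.le_of_le (y := P \ {p}) ⟨Set.sdiff_subset.trans hPA, ⟨hxP, hpx.symm⟩,
      ⟨hwP, hpw.symm⟩, h⟩ Set.sdiff_subset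
    exact (this hp).2 rfl
  let Q : Set V := {q | G.ConnIn (A \ P) w' q}
  have hw'Q : w' ∈ Q := Relation.ReflTransGen.refl
  have hQsub : ∀ q ∈ Q, q ∈ A ∧ q ∉ P := fun q hq =>
    ConnIn.mem (A := A \ P) hq ⟨hwA', hw'P⟩
  -- A path from `w'` to `P` avoiding `a` first leaves the component `Q` at a vertex of `P` other
  -- than `a`.
  have hQtouch : ∀ a b, b ∈ P → G.ConnIn (A \ {a}) w' b → ∃ p ∈ P, p ≠ a ∧ G.Touch {p} Q := by
    intro a b hb h
    obtain ⟨q, r, hqr, hq, hr, hqQ, hrQ⟩ := h.exists_exit (C := Q) hw'Q fun h => (hQsub b h).2 hb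
    refine ⟨r, ?_, hr.2, r, rfl, q, hqQ, hqr.symm⟩
    by_contra hrP
    exact hrQ (Relation.ReflTransGen.tail hqQ ⟨hqr, hQsub q hqQ, hr.1, hrP⟩)
  by_cases hclaw : ∃ p ∈ P, p ≠ x ∧ p ≠ w ∧ G.Touch {p} Q
  -- `Q` attaches at an inner vertex `p`: then `p`, `S`, `v` each touch the part of `x`, the part of
  -- `w`, and `Q`, giving `K₃,₃`.
  · obtain ⟨p, hp, hpx, hpw, hpQ⟩ := hclaw
    have hcut := hPcut p hp hpx hpw
    let X : Set V := {q | G.ConnIn (P \ {p}) x q}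
    let W : Set V := {q | G.ConnIn (P \ {p}) w q}
    have hXs : ∀ q ∈ X, q ∈ P ∧ q ≠ p := fun q hq => ConnIn.mem (A := P \ {p}) hq ⟨hxP, hpx.symm⟩
    have hWs : ∀ q ∈ W, q ∈ P ∧ q ≠ p := fun q hq => ConnIn.mem (A := P \ {p}) hq ⟨hwP, hpw.symm⟩
    have hXW : ∀ q ∈ X, q ∉ W := fun q hq hq' => hcut (Relation.ReflTransGen.trans hq (ConnIn.symm hq'))
    have hpX : G.Touch {p} X := hPc.touch hxP hpx.symm hcut
    have hpW : G.Touch {p} W := hPc.symm.touch hwP hpw.symm fun h => hcut h.symm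
    have hxX : {x} ⊆ X := Set.singleton_subset_iff.2 Relation.ReflTransGen.refl
    have hwW : {w} ⊆ W := Set.singleton_subset_iff.2 Relation.ReflTransGen.refl
    have hwQ : {w'} ⊆ Q := Set.singleton_subset_iff.2 hw'Q
    refine h33 (Sum.elim ![{p}, S, {v}] ![X, W, Q]) ?_ ?_ ?_
    · classical
      -- Disjointness of the branch sets is proved by a function that recovers the index from a
      -- member.
      let label : V → Fin 3 ⊕ Fin 3 := fun u => if u ∈ S then Sum.inl 1 else if u = v then Sum.inl 2
        else if u = p then Sum.inl 0 else if u ∈ X then Sum.inr 0 else if u ∈ W then Sum.inr 1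
        else Sum.inr 2
      have hA : ∀ u ∈ A, u ∉ S ∧ u ≠ v := fun u hu => ⟨fun h => hSA u h hu, fun h => hvA (h ▸ hu)⟩
      have hlabel : ∀ i u, u ∈ (Sum.elim ![{p}, S, {v}] ![X, W, Q] : Fin 3 ⊕ Fin 3 → Set V) i →
          label u = i := by
        rintro (i | i) u hu <;> fin_cases i
        · obtain rfl : u = p := hu
          obtain ⟨a1, a2⟩ := hA u (hPsub u hp)
          simp [label, a1, a2]
        · have a1 : u ∈ S := hu
          simp [label, a1]
        · obtain rfl : u = v := hu
          simp [label, hvS]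
        · have a0 : u ∈ X := hu
          obtain ⟨a1, a2⟩ := hA u (hPsub u (hXs u a0).1)
          simp [label, a1, a2, (hXs u a0).2, a0]
        · have a0 : u ∈ W := hu
          obtain ⟨a1, a2⟩ := hA u (hPsub u (hWs u a0).1)
          have a3 : u ∉ X := fun h => hXW u h a0
          simp [label, a1, a2, (hWs u a0).2, a0, a3]
        · have a0 : u ∈ Q := hu
          obtain ⟨a1, a2⟩ := hA u (hQsub u a0).1
          have a3 := (hQsub u a0).2
          have a4 : u ≠ p := fun h => a3 (h ▸ hp)
          have a5 : u ∉ X := fun h => a3 (hXs u h).1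
          have a6 : u ∉ W := fun h => a3 (hWs u h).1
          simp [label, a1, a2, a4, a5, a6]
      exact fun i j u hi hj => (hlabel i u hi).symm.trans (hlabel j u hj)
    · rintro (i | i) <;> fin_cases i
      · exact isConnSet_singleton p
      · exact hS
      · exact isConnSet_singleton v
      · exact isConnSet_connIn _ _
      · exact isConnSet_connIn _ _
      · exact isConnSet_connIn _ _
    · intro i j
      fin_cases i <;> fin_cases j
      · exact hpX
      · exact hpW
      · exact hpQ
      · exact mono hxX sx
      · exact mono hwW sw
      · exact mono hwQ sw'
      · exact ⟨v, rfl, x, hxX rfl, hv⟩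
      · exact ⟨v, rfl, w, hwW rfl, hvw⟩
      · exact ⟨v, rfl, w', hwQ rfl, hvw'⟩
  -- `Q` attaches to `P` only at the ends, and by `c2` and `c3` at both: then `S`, `v`, `w`, the
  -- rest of `P` and `Q` form a `K₅`.
  · push Not at hclaw
    have hxQ : G.Touch {x} Q := by
      obtain ⟨p, hp, hpw, ht⟩ := hQtouch w x hxP c2
      by_cases h : p = x
      · exact h ▸ ht
      · exact absurd ht (hclaw p hp h hpw)
    have hwQ : G.Touch {w} Q := by
      obtain ⟨p, hp, hpx, ht⟩ := hQtouch x w hwP c3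
      by_cases h : p = w
      · exact h ▸ ht
      · exact absurd ht (hclaw p hp hpx h)
    let X : Set V := {q | G.ConnIn (P \ {w}) x q}
    have hXs : ∀ q ∈ X, q ∈ P ∧ q ≠ w := fun q hq => ConnIn.mem (A := P \ {w}) hq ⟨hxP, hxw⟩
    have hxX : {x} ⊆ X := Set.singleton_subset_iff.2 Relation.ReflTransGen.refl
    have hwX : G.Touch {w} X := hPc.touch hxP hxw fun h => (hXs w h).2 rfl
    have hw'Q' : {w'} ⊆ Q := Set.singleton_subset_iff.2 hw'Q
    refine h5 ![S, {v}, {w}, X, Q] ?_ ?_ ?_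
    · classical
      let label : V → Fin 5 := fun u => if u ∈ S then 0 else if u = v then 1
        else if u = w then 2 else if u ∈ X then 3 else 4
      have hA : ∀ u ∈ A, u ∉ S ∧ u ≠ v := fun u hu => ⟨fun h => hSA u h hu, fun h => hvA (h ▸ hu)⟩
      have hlabel : ∀ i u, u ∈ (![S, {v}, {w}, X, Q] : Fin 5 → Set V) i → label u = i := by
        intro i u hu
        fin_cases i
        · have a1 : u ∈ S := hu
          simp [label, a1]
        · obtain rfl : u = v := hu
          simp [label, hvS]
        · obtain rfl : u = w := hu
          obtain ⟨a1, a2⟩ := hA u (hPsub u hwP)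
          simp [label, a1, a2]
        · have a0 : u ∈ X := hu
          obtain ⟨a1, a2⟩ := hA u (hPsub u (hXs u a0).1)
          simp [label, a1, a2, (hXs u a0).2, a0]
        · have a0 : u ∈ Q := hu
          obtain ⟨a1, a2⟩ := hA u (hQsub u a0).1
          have a3 := (hQsub u a0).2
          have a4 : u ≠ w := fun h => a3 (h ▸ hwP)
          have a5 : u ∉ X := fun h => a3 (hXs u h).1
          simp [label, a1, a2, a4, a5]
      exact fun i j u hi hj => (hlabel i u hi).symm.trans (hlabel j u hj)
    · intro i
      fin_cases i
      · exact hS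
      · exact isConnSet_singleton v
      · exact isConnSet_singleton w
      · exact isConnSet_connIn _ _
      · exact isConnSet_connIn _ _
    · have hs : ∀ i : Fin 5, 0 < i → G.Touch S ((![S, {v}, {w}, X, Q] : Fin 5 → Set V) i) := by
        intro i hi
        fin_cases i
        · exact absurd hi (lt_irrefl _)
        · exact sv
        · exact sw
        · exact mono hxX sx
        · exact mono hw'Q' sw'
      have hs1 : ∀ i : Fin 5, 1 < i → G.Touch {v} ((![S, {v}, {w}, X, Q] : Fin 5 → Set V) i) := by
        intro i hi
        fin_cases i
        · exact absurd hi (by decide)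
        · exact absurd hi (by decide)
        · exact ⟨v, rfl, w, rfl, hvw⟩
        · exact ⟨v, rfl, x, hxX rfl, hv⟩
        · exact ⟨v, rfl, w', hw'Q, hvw'⟩
      have hs2 : ∀ i : Fin 5, 2 < i → G.Touch {w} ((![S, {v}, {w}, X, Q] : Fin 5 → Set V) i) := by
        intro i hi
        fin_cases i
        · exact absurd hi (by decide)
        · exact absurd hi (by decide)
        · exact absurd hi (by decide)
        · exact hwX
        · exact hwQ
      intro i j hij
      fin_cases i
      · exact hs j hij
      · exact hs1 j hij
      · exact hs2 j hij
      · obtain rfl : j = 4 := by revert hij; revert j; decide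
        obtain ⟨x', rfl, q, hq, h⟩ := hxQ
        exact ⟨x', hxX rfl, q, hq, h⟩
      · exact absurd hij (by revert j; decide)

end SimpleGraph

/-! ### Coefficients of graph polynomials -/

open MvPolynomial in
/-- The linear form of an edge with coefficients `κ`. -/
noncomputable def edgeForm {V : Type*} (κ : V → V → ℤ) : Sym2 V → MvPolynomial V ℤ :=
  Sym2.lift ⟨fun u v => C (κ u v) * X u + C (κ v u) * X v, fun _ _ => add_comm _ _⟩

/-- The graph polynomial of a set of edges. -/
noncomputable def edgePoly {V : Type*} (κ : V → V → ℤ) (E : Finset (Sym2 V)) : MvPolynomial V ℤ :=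
  ∏ e ∈ E, edgeForm κ e

section

open MvPolynomial

variable {V : Type*} {κ : V → V → ℤ}

theorem edgeForm_mk (u v : V) : edgeForm κ s(u, v) = C (κ u v) * X u + C (κ v u) * X v := rfl

theorem coeff_mul_C_mul_X (P : MvPolynomial V ℤ) (a : ℤ) (u : V) (m : V →₀ ℕ) :
    coeff (m + Finsupp.single u 1) (P * (C a * X u)) = a * coeff m P := by
  rw [← mul_assoc, coeff_mul_X, mul_comm P, coeff_C_mul]

theorem coeff_mul_C_mul_X_of_eq_zero (P : MvPolynomial V ℤ) (a : ℤ) {u : V} {m : V →₀ ℕ}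
    (h : m u = 0) : coeff m (P * (C a * X u)) = 0 := by
  classical
  rw [← mul_assoc, coeff_mul_X', if_neg (by simpa using h)]

theorem coeff_mul_edgeForm_add (P : MvPolynomial V ℤ) (m : V →₀ ℕ) (u v : V) :
    coeff (m + Finsupp.single u 1 + Finsupp.single v 1) (P * edgeForm κ s(u, v)) =
      κ u v * coeff (m + Finsupp.single v 1) P + κ v u * coeff (m + Finsupp.single u 1) P := by
  rw [edgeForm_mk, mul_add, coeff_add, coeff_mul_C_mul_X, add_right_comm, coeff_mul_C_mul_X]

theorem coeff_mul_edgeForm_of_eq_zero (P : MvPolynomial V ℤ) {m : V →₀ ℕ} {u v : V} (huv : u ≠ v)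
    (h : m u = 0) :
    coeff (m + Finsupp.single v 1) (P * edgeForm κ s(u, v)) = κ v u * coeff m P := by
  rw [edgeForm_mk, mul_add, coeff_add, coeff_mul_C_mul_X, coeff_mul_C_mul_X_of_eq_zero, zero_add]
  rw [Finsupp.add_apply, h, Finsupp.single_eq_of_ne huv, zero_add]

theorem coeff_edgePoly_eq_zero {E : Finset (Sym2 V)} {m : V →₀ ℕ} {v : V} (hv : ∀ e ∈ E, v ∉ e)
    (hm : m v ≠ 0) : coeff m (edgePoly κ E) = 0 := by
  classical
  induction E using Finset.induction_on generalizing m with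
  | empty =>
    rw [edgePoly, Finset.prod_empty, coeff_one, if_neg]
    rintro rfl
    exact hm rfl
  | insert e E he ih =>
    have h1 : ∀ (a : ℤ) (u : V), u ≠ v → coeff m (edgePoly κ E * (C a * X u)) = 0 := by
      intro a u hu
      rw [← mul_assoc, coeff_mul_X']
      split_ifs
      · rw [mul_comm, coeff_C_mul, ih (fun e he => hv e (Finset.mem_insert_of_mem he)), mul_zero]
        rwa [Finsupp.tsub_apply, Finsupp.single_eq_of_ne hu.symm, tsub_zero]
      · rfl
    have h2 := hv e (Finset.mem_insert_self _ _)
    rw [edgePoly, Finset.prod_insert he, mul_comm]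
    change coeff m (edgePoly κ E * edgeForm κ e) = 0
    induction e with | _ a b =>
    rw [Sym2.mem_iff, not_or] at h2
    rw [edgeForm_mk, mul_add, coeff_add, h1 _ _ (Ne.symm h2.1), h1 _ _ (Ne.symm h2.2), add_zero]

theorem isHomogeneous_edgePoly (E : Finset (Sym2 V)) : (edgePoly κ E).IsHomogeneous E.card := by
  have h : ∀ e : Sym2 V, (edgeForm κ e).IsHomogeneous 1 := by
    intro e
    induction e with | _ a b =>
    have : ∀ (c : ℤ) (u : V), (C c * X u : MvPolynomial V ℤ).IsHomogeneous 1 := by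
      intro c u
      simpa using (isHomogeneous_C V c).mul (isHomogeneous_X ℤ u)
    exact (this _ _).add (this _ _)
  have := IsHomogeneous.prod E (edgeForm κ) (fun _ => 1) fun e _ => h e
  simpa [edgePoly] using this

theorem degree_eq_of_coeff_edgePoly_ne_zero {E : Finset (Sym2 V)} {m : V →₀ ℕ}
    (h : coeff m (edgePoly κ E) ≠ 0) : Finsupp.degree m = E.card := by
  by_contra hne
  exact h ((isHomogeneous_edgePoly E).coeff_eq_zero hne)

/-- No cancellation occurs. Where `m₂` is positive the first factor has no variable, so the second
exponent of any contributing pair dominates `m₂`; homogeneity then forces equality. -/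
theorem coeff_mul_edgePoly {E₁ E₂ : Finset (Sym2 V)} {m₁ m₂ : V →₀ ℕ}
    (h₁ : coeff m₁ (edgePoly κ E₁) ≠ 0) (h₂ : coeff m₂ (edgePoly κ E₂) ≠ 0)
    (h : ∀ u, m₂ u = 0 ∨ ∀ e ∈ E₁, u ∉ e) :
    coeff (m₁ + m₂) (edgePoly κ E₁ * edgePoly κ E₂) ≠ 0 := by
  classical
  rw [coeff_mul, Finset.sum_eq_single (m₁, m₂)]
  · exact mul_ne_zero h₁ h₂
  · rintro ⟨a, b⟩ hab hne
    replace hab : a + b = m₁ + m₂ := Finset.HasAntidiagonal.mem_antidiagonal.1 hab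
    replace hne : ¬ (a = m₁ ∧ b = m₂) := fun h => hne (Prod.ext h.1 h.2)
    by_contra hc
    obtain ⟨ha, hb⟩ := mul_ne_zero_iff.1 hc
    have hle : m₂ ≤ b := by
      intro u
      rcases h u with hu | hu
      · rw [hu]; exact Nat.zero_le _
      · have a0 : a u = 0 := by_contra fun h => ha (coeff_edgePoly_eq_zero hu h)
        have a1 : m₁ u = 0 := by_contra fun h => h₁ (coeff_edgePoly_eq_zero hu h)
        have := DFunLike.congr_fun hab u
        simp only [Finsupp.add_apply, a0, a1, zero_add] at this
        exact this.ge
    have hdeg := (degree_eq_of_coeff_edgePoly_ne_zero hb).trans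
      (degree_eq_of_coeff_edgePoly_ne_zero h₂).symm
    have hb2 : b = m₂ := by
      obtain ⟨c, rfl⟩ := le_iff_exists_add.1 hle
      rw [map_add, Nat.add_eq_left, Finsupp.degree_eq_zero_iff] at hdeg
      rw [hdeg, add_zero]
    subst hb2
    exact hne ⟨add_right_cancel hab, rfl⟩
  · intro h
    refine absurd ?_ h
    rw [Finset.HasAntidiagonal.mem_antidiagonal]

/-- The indicator of a set of vertices as a monomial. -/
noncomputable def ind (N : Finset V) : V →₀ ℕ := ∑ u ∈ N, Finsupp.single u 1

theorem ind_apply [DecidableEq V] (N : Finset V) (w : V) : ind N w = if w ∈ N then 1 else 0 := by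
  simp [ind, Finsupp.finsetSum_apply, Finsupp.single_apply]

theorem ind_insert [DecidableEq V] {N : Finset V} {u : V} (hu : u ∉ N) :
    ind (insert u N) = ind N + Finsupp.single u 1 := by
  rw [ind, Finset.sum_insert hu, add_comm, ind]

/-- The product of the edge forms of a star. -/
noncomputable def starPoly (κ : V → V → ℤ) (v : V) (N : Finset V) : MvPolynomial V ℤ :=
  ∏ u ∈ N, edgeForm κ s(v, u)

theorem starPoly_insert [DecidableEq V] {v u : V} {N : Finset V} (hu : u ∉ N) :
    starPoly κ v (insert u N) = starPoly κ v N * edgeForm κ s(v, u) := by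
  rw [starPoly, Finset.prod_insert hu, mul_comm, starPoly]

/-- The exponent of `v` is zero, so every star edge must contribute the variable of its leaf. -/
theorem coeff_mul_starPoly (hκ : ∀ u v, κ u v ≠ 0) (P : MvPolynomial V ℤ) {m : V →₀ ℕ} {v : V}
    {N : Finset V} (hm : m v = 0) (hN : v ∉ N) :
    coeff (m + ind N) (P * starPoly κ v N) ≠ 0 ↔ coeff m P ≠ 0 := by
  classical
  induction N using Finset.induction_on with
  | empty => simp [ind, starPoly]
  | insert u N hu ih =>
    rw [Finset.mem_insert, not_or] at hN
    rw [ind_insert hu, starPoly_insert hu, ← add_assoc, ← mul_assoc,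
      coeff_mul_edgeForm_of_eq_zero _ hN.1, mul_ne_zero_iff, ih hN.2]
    · exact and_iff_right (hκ _ _)
    · rw [Finsupp.add_apply, hm, ind_apply, if_neg hN.2]

/-- The exponent of `x` is zero, so `vx` contributes `X_v`; this uses up the exponent of `v`, and
the other edges contribute their leaves. -/
theorem coeff_mul_starPoly_insert (hκ : ∀ u v, κ u v ≠ 0) (P : MvPolynomial V ℤ) {m : V →₀ ℕ}
    {v x : V} [DecidableEq V] {N : Finset V} (hm : m v = 0) (hN : v ∉ N) (hx : m x = 0)
    (hxN : x ∉ N) (hxv : x ≠ v) :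
    coeff (m + ind N + Finsupp.single v 1) (P * starPoly κ v (insert x N)) ≠ 0 ↔ coeff m P ≠ 0 := by
  rw [starPoly_insert hxN, ← mul_assoc, Sym2.eq_swap, coeff_mul_edgeForm_of_eq_zero _ hxv,
    mul_ne_zero_iff, coeff_mul_starPoly hκ P hm hN]
  · exact and_iff_right (hκ _ _)
  · rw [Finsupp.add_apply, hx, ind_apply, if_neg hxN]

/-- Since `P` is free of `v`, exactly one star edge `vi` contributes `X_v`; its leaf variable then
has to come from `P`, with exponent `m + single i 1`. -/
theorem coeff_mul_starPoly_eq_zero (P : MvPolynomial V ℤ) {m : V →₀ ℕ} {v : V} {N : Finset V}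
    (hκ : ∀ u v, κ u v ≠ 0) (hm : m v = 0) (hN : v ∉ N)
    (hP : ∀ n : V →₀ ℕ, n v ≠ 0 → coeff n P = 0)
    (h : ∀ i ∈ N, coeff (m + Finsupp.single i 1) P = 0) :
    coeff (m + ind N + Finsupp.single v 1) (P * starPoly κ v N) = 0 := by
  classical
  induction N using Finset.induction_on with
  | empty =>
    rw [starPoly, Finset.prod_empty, mul_one]
    exact hP _ (by simp)
  | insert u N hu ih =>
    rw [Finset.mem_insert, not_or] at hN
    rw [ind_insert hu, starPoly_insert hu, ← add_assoc, ← mul_assoc, Sym2.eq_swap,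
      coeff_mul_edgeForm_add, ih hN.2 fun i hi => h i (Finset.mem_insert_of_mem hi), mul_zero,
      zero_add]
    have h1 : coeff (m + Finsupp.single u 1 + ind N) (P * starPoly κ v N) = 0 := by
      by_contra hc
      refine (coeff_mul_starPoly hκ P ?_ hN.2).1 hc (h u (Finset.mem_insert_self _ _))
      rw [Finsupp.add_apply, hm, Finsupp.single_eq_of_ne hN.1, zero_add]
    rw [add_right_comm, h1, mul_zero]

/-- The exchange step. The edge `vx` contributes `X_v`. If `vw` does too, what remains is a nonzero
multiple of `coeff m P`; only terms where `vw` contributes `X_w` can cancel it, and these come from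
monomials of `P` in which one `w` of `m` is traded for some `i ∈ N`. -/
theorem coeff_mul_starPoly_alternative (hκ : ∀ u v, κ u v ≠ 0) (P : MvPolynomial V ℤ) {m : V →₀ ℕ}
    {v x w : V} [DecidableEq V] {N : Finset V} (hm : m v = 0) (hN : v ∉ N) (hx : m x = 0)
    (hxN : x ∉ insert w N) (hxv : x ≠ v) (hwv : w ≠ v) (hwN : w ∉ N)
    (hP : ∀ n : V →₀ ℕ, n v ≠ 0 → coeff n P = 0) (hmP : coeff m P ≠ 0) :
    coeff (m + ind N + Finsupp.single v 1 + Finsupp.single v 1)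
      (P * starPoly κ v (insert x (insert w N))) ≠ 0 ∨
    ∃ i ∈ N, ∃ m₀, m = m₀ + Finsupp.single w 1 ∧ coeff (m₀ + Finsupp.single i 1) P ≠ 0 := by
  by_cases hi : ∃ i ∈ N, ∃ m₀, m = m₀ + Finsupp.single w 1 ∧ coeff (m₀ + Finsupp.single i 1) P ≠ 0
  · exact Or.inr hi
  refine Or.inl ?_
  push Not at hi
  have h0 := (coeff_mul_starPoly hκ P hm hN).2 hmP
  rw [starPoly_insert hxN, ← mul_assoc, Sym2.eq_swap, coeff_mul_edgeForm_of_eq_zero _ hxv]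
  swap
  · rw [Finset.mem_insert, not_or] at hxN
    rw [Finsupp.add_apply, Finsupp.add_apply, hx, ind_apply, if_neg hxN.2,
      Finsupp.single_eq_of_ne hxv, zero_add, zero_add]
  refine mul_ne_zero (hκ _ _) ?_
  rw [starPoly_insert hwN, ← mul_assoc, Sym2.eq_swap]
  by_cases hw : m w = 0
  · rw [coeff_mul_edgeForm_of_eq_zero _ hwv]
    · exact mul_ne_zero (hκ _ _) h0
    · rw [Finsupp.add_apply, hw, ind_apply, if_neg hwN]
  · obtain ⟨m₀, rfl⟩ : ∃ m₀, m = m₀ + Finsupp.single w 1 :=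
      ⟨m - Finsupp.single w 1, (tsub_add_cancel_of_le (by
        rw [Finsupp.single_le_iff]; exact Nat.one_le_iff_ne_zero.2 hw)).symm⟩
    have hm₀ : m₀ v = 0 := by
      rw [Finsupp.add_apply] at hm
      omega
    rw [add_right_comm m₀, coeff_mul_edgeForm_add,
      coeff_mul_starPoly_eq_zero P hκ hm₀ hN hP fun i h => hi i h m₀ rfl, mul_zero, zero_add,
      add_right_comm]
    exact mul_ne_zero (hκ _ _) h0

end

/-! ### The induction statement: simple deletions and gluing -/

open MvPolynomial

section

open scoped Classical

variable {V : Type*} [Fintype V] (G : SimpleGraph V) (κ : V → V → ℤ)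

/-- The edges of `G` inside `U` which are not inside `R`. -/
noncomputable def innerEdges (U R : Finset V) : Finset (Sym2 V) :=
  Finset.univ.filter fun e => e ∈ G.edgeSet ∧ (∀ v ∈ e, v ∈ U) ∧ ¬ ∀ v ∈ e, v ∈ R

/-- The neighbors of `v` in `U`. -/
noncomputable def nbrs {V : Type*} (G : SimpleGraph V) (U : Finset V) (v : V) : Finset V := U.filter fun u => G.Adj v u

/-- The number of edges of `M` at `v`. -/
noncomputable def edgeDegree {V : Type*} (M : Finset (Sym2 V)) (v : V) : ℕ :=
  (M.filter fun e => v ∈ e).card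

/-- There is a matching `M` inside `U` such that the graph polynomial of the other edges has a
monomial which together with `M` has degree `0` on `R`, at most `2` on `B` and at most `3`
elsewhere. -/
def HasMonomial (U B R : Finset V) : Prop :=
  ∃ (M : Finset (Sym2 V)) (m : V →₀ ℕ), M ⊆ innerEdges G U R ∧ (∀ v, edgeDegree M v ≤ 1) ∧
    (∀ v ∈ R, m v = 0 ∧ edgeDegree M v = 0) ∧ (∀ v ∈ B, m v + edgeDegree M v ≤ 2) ∧
    (∀ v, m v ≤ 3) ∧ coeff m (edgePoly κ (innerEdges G U R \ M)) ≠ 0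

variable {G κ}

theorem mk_mem_innerEdges {U R : Finset V} {u v : V} :
    s(u, v) ∈ innerEdges G U R ↔ G.Adj u v ∧ (u ∈ U ∧ v ∈ U) ∧ ¬ (u ∈ R ∧ v ∈ R) := by
  simp only [innerEdges, Finset.mem_filter, Finset.mem_univ, true_and, SimpleGraph.mem_edgeSet,
    Sym2.mem_iff, forall_eq_or_imp, forall_eq]

theorem mem_nbrs {V : Type*} {G : SimpleGraph V} {U : Finset V} {u v : V} : u ∈ nbrs G U v ↔ u ∈ U ∧ G.Adj v u :=
  Finset.mem_filter

theorem mem_of_mem_innerEdges {U R : Finset V} {e : Sym2 V} (he : e ∈ innerEdges G U R) {v : V}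
    (hv : v ∈ e) : v ∈ U :=
  (Finset.mem_filter.1 he).2.2.1 v hv

theorem edgeDegree_eq_zero_iff {V : Type*} {M : Finset (Sym2 V)} {v : V} :
    edgeDegree M v = 0 ↔ ∀ e ∈ M, v ∉ e := by
  rw [edgeDegree, Finset.card_eq_zero, Finset.filter_eq_empty_iff]

theorem edgeDegree_eq_zero_of_notMem {U R : Finset V} {M : Finset (Sym2 V)}
    (hM : M ⊆ innerEdges G U R) {v : V} (hv : v ∉ U) : edgeDegree M v = 0 :=
  edgeDegree_eq_zero_iff.2 fun _ he h => hv (mem_of_mem_innerEdges (hM he) h)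

theorem edgeDegree_union {V : Type*} {M₁ M₂ : Finset (Sym2 V)} (h : Disjoint M₁ M₂) (v : V) :
    edgeDegree (M₁ ∪ M₂) v = edgeDegree M₁ v + edgeDegree M₂ v := by
  rw [edgeDegree, Finset.filter_union, Finset.card_union_of_disjoint]
  · rfl
  · exact Finset.disjoint_filter_filter h

theorem edgeDegree_insert {V : Type*} {M : Finset (Sym2 V)} {e : Sym2 V} (h : e ∉ M) (v : V) :
    edgeDegree (insert e M) v = edgeDegree M v + if v ∈ e then 1 else 0 := by
  rw [edgeDegree, Finset.filter_insert]
  split_ifs with hv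
  · rw [Finset.card_insert_of_notMem fun h' => h (Finset.mem_filter.1 h').1]
    rfl
  · rfl

theorem exponent_eq_zero_of_notMem {U R : Finset V} {E : Finset (Sym2 V)}
    (hE : E ⊆ innerEdges G U R) {v : V} (hv : v ∉ U) {m : V →₀ ℕ}
    (hm : coeff m (edgePoly κ E) ≠ 0) : m v = 0 :=
  by_contra fun h => hm (coeff_edgePoly_eq_zero
    (fun _ he hve => hv (mem_of_mem_innerEdges (hE he) hve)) h)

/-- The edges at `v` to the vertices of `N`. -/
noncomputable def starEdges {V : Type*} (v : V) (N : Finset V) : Finset (Sym2 V) :=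
  N.image fun u => s(v, u)

theorem mem_star {V : Type*} {v : V} {N : Finset V} {e : Sym2 V} (he : e ∈ starEdges v N) : v ∈ e := by
  obtain ⟨u, -, rfl⟩ := Finset.mem_image.1 he
  exact Sym2.mem_mk_left _ _

theorem edgePoly_star {V : Type*} {κ : V → V → ℤ} (v : V) (N : Finset V) : edgePoly κ (starEdges v N) = starPoly κ v N := by
  rw [edgePoly, starEdges, Finset.prod_image, starPoly]
  intro a _ b _ h
  exact Sym2.congr_right.1 h

theorem edgePoly_union {V : Type*} {κ : V → V → ℤ} {E F : Finset (Sym2 V)} (h : Disjoint E F) :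
    edgePoly κ (E ∪ F) = edgePoly κ E * edgePoly κ F :=
  Finset.prod_union h

theorem innerEdges_eq_union_star {U R N : Finset V} {v : V} (hv : v ∈ U)
    (hN : ∀ u, u ∈ N ↔ u ∈ nbrs G U v ∧ ¬ (v ∈ R ∧ u ∈ R)) :
    innerEdges G U R = innerEdges G (U.erase v) (R.erase v) ∪ starEdges v N := by
  have key : ∀ u, s(v, u) ∈ innerEdges G U R ↔ s(v, u) ∈ starEdges v N := by
    intro u
    rw [mk_mem_innerEdges, starEdges, Finset.mem_image]
    constructor
    · rintro ⟨h1, h2, h3⟩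
      exact ⟨u, (hN u).2 ⟨mem_nbrs.2 ⟨h2.2, h1⟩, h3⟩, rfl⟩
    · rintro ⟨u', hu', h⟩
      obtain rfl := Sym2.congr_right.1 h
      obtain ⟨h1, h2⟩ := (hN u').1 hu'
      rw [mem_nbrs] at h1
      exact ⟨h1.2, ⟨hv, h1.1⟩, h2⟩
  ext e
  rw [Finset.mem_union]
  by_cases hve : v ∈ e
  · obtain ⟨u, rfl⟩ := Sym2.mem_iff_exists.1 hve
    rw [key]
    refine ⟨Or.inr, fun h => h.resolve_left fun h => ?_⟩
    exact Finset.notMem_erase _ _ (mem_of_mem_innerEdges h hve)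
  · have h1 : e ∉ starEdges v N := fun h => hve (mem_star h)
    induction e with | _ a b =>
    rw [Sym2.mem_iff, not_or] at hve
    simp only [mk_mem_innerEdges, Finset.mem_erase, h1, or_false, ne_eq, Ne.symm hve.1,
      Ne.symm hve.2, not_false_eq_true, true_and]

theorem disjoint_star {U R N : Finset V} {v : V} :
    Disjoint (innerEdges G (U.erase v) R) (starEdges v N) :=
  Finset.disjoint_left.2 fun _ h1 h2 =>
    Finset.notMem_erase _ _ (mem_of_mem_innerEdges h1 (mem_star h2))

theorem union_star_sdiff {U R N : Finset V} {v : V} {M : Finset (Sym2 V)}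
    (hM : M ⊆ innerEdges G (U.erase v) R) :
    (innerEdges G (U.erase v) R ∪ starEdges v N) \ M = innerEdges G (U.erase v) R \ M ∪ starEdges v N := by
  rw [Finset.union_sdiff_distrib, Finset.sdiff_eq_self_of_disjoint (disjoint_star.mono_left hM).symm]

theorem edgePoly_union_star {U R N : Finset V} {v : V} {M : Finset (Sym2 V)} :
    edgePoly κ (innerEdges G (U.erase v) R \ M ∪ starEdges v N) =
      edgePoly κ (innerEdges G (U.erase v) R \ M) * starPoly κ v N := by
  rw [edgePoly_union (disjoint_star.mono_left Finset.sdiff_subset), edgePoly_star]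

theorem HasMonomial.empty : HasMonomial G κ ∅ ∅ ∅ := by
  have : innerEdges G ∅ ∅ = (∅ : Finset (Sym2 V)) := by
    refine Finset.eq_empty_of_forall_notMem fun e he => ?_
    induction e with | _ a b => exact absurd (mk_mem_innerEdges.1 he).2.1.1 (Finset.notMem_empty _)
  refine ⟨∅, 0, Finset.empty_subset _, ?_, ?_, ?_, ?_, ?_⟩
  · simp [edgeDegree]
  · simp
  · simp
  · simp
  · simp [this, edgePoly]

/-- Deletion of a vertex whose other neighbors are not on the boundary. -/
theorem HasMonomial.of_erase (hκ : ∀ u v, κ u v ≠ 0) {U B B' R : Finset V} {v : V} (hv : v ∈ U)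
    (hvR : v ∈ R ∨ R = ∅) (hB : ∀ u ∈ B, u ≠ v → u ∈ B') (hB' : ∀ u ∈ nbrs G U v, u ∈ B')
    (hvB : ∀ u ∈ nbrs G U v, u ∈ B → u ∈ R)
    (h : HasMonomial G κ (U.erase v) B' (R.erase v)) : HasMonomial G κ U B R := by
  obtain ⟨M, m, h1, h2, h3, h4, h5, h6⟩ := h
  set N := nbrs G U v \ R with hNdef
  have hmv : m v = 0 := exponent_eq_zero_of_notMem Finset.sdiff_subset (Finset.notMem_erase v U) h6
  have hMv : edgeDegree M v = 0 := edgeDegree_eq_zero_of_notMem h1 (Finset.notMem_erase v U)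
  have hvN : v ∉ N := fun h => (mem_nbrs.1 (Finset.mem_sdiff.1 h).1).2.ne rfl
  have hU : innerEdges G U R = innerEdges G (U.erase v) (R.erase v) ∪ starEdges v N := by
    refine innerEdges_eq_union_star hv fun u => ?_
    rw [hNdef, Finset.mem_sdiff]
    refine and_congr_right fun _ => not_congr ⟨fun h => ⟨?_, h⟩, And.right⟩
    exact hvR.resolve_right fun h0 => by simp [h0] at h
  refine ⟨M, m + ind N, ?_, h2, ?_, ?_, ?_, ?_⟩
  · rw [hU]
    exact h1.trans Finset.subset_union_left
  · intro u hu
    rw [Finsupp.add_apply, ind_apply, if_neg fun h => (Finset.mem_sdiff.1 h).2 hu]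
    by_cases huv : u = v
    · subst huv; exact ⟨hmv, hMv⟩
    · exact h3 u (Finset.mem_erase.2 ⟨huv, hu⟩)
  · intro u hu
    rw [Finsupp.add_apply, ind_apply, if_neg]
    · by_cases huv : u = v
      · subst huv; omega
      · exact h4 u (hB u hu huv)
    · intro h
      rw [Finset.mem_sdiff] at h
      exact h.2 (hvB u h.1 hu)
  · intro u
    rw [Finsupp.add_apply, ind_apply]
    split_ifs with h
    -- A neighbour of `v` outside `R` was a boundary vertex of the smaller graph, so its budget of 2
    -- leaves room for one more edge.
    · have := h4 u (hB' u (Finset.mem_sdiff.1 h).1)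
      omega
    · exact h5 u
  · rw [hU, union_star_sdiff h1, edgePoly_union_star]
    exact (coeff_mul_starPoly hκ _ hmv hvN).2 h6

theorem innerEdges_singleton {U : Finset V} {x : V} : innerEdges G U {x} = innerEdges G U ∅ := by
  ext e
  induction e with | _ a b =>
  simp only [mk_mem_innerEdges, Finset.mem_singleton, Finset.notMem_empty, and_self,
    not_false_eq_true, and_true]
  refine and_congr_right fun hab => and_iff_left ?_
  rintro ⟨rfl, rfl⟩
  exact hab.ne rfl

theorem HasMonomial.of_singleton {U B : Finset V} {x : V} (h : HasMonomial G κ U B {x}) :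
    HasMonomial G κ U B ∅ := by
  obtain ⟨M, m, h1, h2, h3, h4, h5, h6⟩ := h
  rw [innerEdges_singleton] at h1 h6
  exact ⟨M, m, h1, h2, by simp, h4, h5, h6⟩

/-- The missing edge `xy` is charged to `y`, whose exponent was zero and becomes 1. -/
theorem HasMonomial.of_pair (hκ : ∀ u v, κ u v ≠ 0) {U B : Finset V} {x y : V} (hx : x ∈ U)
    (hy : y ∈ U) (hxy : G.Adj x y) (h : HasMonomial G κ U B {x, y}) : HasMonomial G κ U B {x} := by
  obtain ⟨M, m, h1, h2, h3, h4, h5, h6⟩ := h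
  have hU : innerEdges G U {x} = insert s(x, y) (innerEdges G U {x, y}) := by
    ext e
    induction e with | _ a b =>
    simp only [Finset.mem_insert, mk_mem_innerEdges, Finset.mem_singleton, Sym2.eq_iff]
    constructor
    · rintro ⟨hab, h2, h3⟩
      by_cases h : (a = x ∧ b = y) ∨ (a = y ∧ b = x)
      · exact Or.inl h
      · refine Or.inr ⟨hab, h2, ?_⟩
        rintro ⟨rfl | rfl, rfl | rfl⟩
        · exact hab.ne rfl
        · exact h (Or.inl ⟨rfl, rfl⟩)
        · exact h (Or.inr ⟨rfl, rfl⟩)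
        · exact hab.ne rfl
    · rintro ((⟨rfl, rfl⟩ | ⟨rfl, rfl⟩) | ⟨h1, h2, h3⟩)
      · exact ⟨hxy, ⟨hx, hy⟩, fun h => hxy.ne h.2.symm⟩
      · exact ⟨hxy.symm, ⟨hy, hx⟩, fun h => hxy.ne h.1.symm⟩
      · exact ⟨h1, h2, fun h => h3 ⟨Or.inl h.1, Or.inl h.2⟩⟩
  have hnot : s(x, y) ∉ innerEdges G U {x, y} := by simp [mk_mem_innerEdges]
  obtain ⟨m1, m2⟩ := h3 x (by simp)
  obtain ⟨m3, m4⟩ := h3 y (by simp)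
  refine ⟨M, m + Finsupp.single y 1, ?_, h2, ?_, ?_, ?_, ?_⟩
  · rw [hU]
    exact h1.trans (Finset.subset_insert _ _)
  · intro u hu
    rw [Finset.mem_singleton] at hu
    subst hu
    rw [Finsupp.add_apply, m1, Finsupp.single_eq_of_ne hxy.ne]
    exact ⟨rfl, m2⟩
  · intro u hu
    rw [Finsupp.add_apply]
    by_cases huy : u = y
    · subst huy
      rw [m3, m4, Finsupp.single_eq_same]
      omega
    · rw [Finsupp.single_eq_of_ne huy]
      exact h4 u hu
  · intro u
    rw [Finsupp.add_apply]
    by_cases huy : u = y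
    · subst huy
      rw [m3, Finsupp.single_eq_same]
      omega
    · rw [Finsupp.single_eq_of_ne huy]
      exact h5 u
  · rw [hU, Finset.insert_sdiff_of_notMem _ fun h => hnot (h1 h), edgePoly,
      Finset.prod_insert fun h => hnot (Finset.mem_sdiff.1 h).1, mul_comm,
      coeff_mul_edgeForm_of_eq_zero _ hxy.ne m1]
    exact mul_ne_zero (hκ _ _) h6

/-- Gluing along an edge `vz`. -/
theorem HasMonomial.glue {U U₁ U₂ B R : Finset V} {v z : V} (hU : U = U₁ ∪ U₂)
    (hU₁₂ : ∀ u, u ∈ U₁ ∧ u ∈ U₂ ↔ u = v ∨ u = z) (hRU : R ⊆ U₁)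
    (hsep : ∀ a b, G.Adj a b → a ∈ U₁ → b ∈ U₂ → a ∈ U₂ ∨ b ∈ U₁)
    (h₁ : HasMonomial G κ U₁ (B ∩ U₁) R) (h₂ : HasMonomial G κ U₂ (B ∩ U₂) {v, z}) :
    HasMonomial G κ U B R := by
  obtain ⟨M, m, h1, h2, h3, h4, h5, h6⟩ := h₁
  obtain ⟨M', m', k1, k2, k3, k4, k5, k6⟩ := h₂
  have hdisj : Disjoint (innerEdges G U₁ R) (innerEdges G U₂ {v, z}) := by
    refine Finset.disjoint_left.2 fun e he he' => ?_
    induction e with | _ a b =>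
    rw [mk_mem_innerEdges] at he he'
    have ha := (hU₁₂ a).1 ⟨he.2.1.1, he'.2.1.1⟩
    have hb := (hU₁₂ b).1 ⟨he.2.1.2, he'.2.1.2⟩
    refine he'.2.2 ?_
    simpa using ⟨ha, hb⟩
  have hin : innerEdges G U R = innerEdges G U₁ R ∪ innerEdges G U₂ {v, z} := by
    ext e
    induction e with | _ a b =>
    rw [Finset.mem_union, mk_mem_innerEdges, mk_mem_innerEdges, mk_mem_innerEdges, hU,
      Finset.mem_union, Finset.mem_union]
    have hz : ∀ u, u ∈ ({v, z} : Finset V) ↔ u ∈ U₁ ∧ u ∈ U₂ := fun u => by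
      rw [hU₁₂ u, Finset.mem_insert, Finset.mem_singleton]
    rw [hz, hz]
    constructor
    · rintro ⟨hab, ⟨ha, hb⟩, hR⟩
      by_cases h : a ∈ U₁ ∧ b ∈ U₁
      · exact Or.inl ⟨hab, h, hR⟩
      · refine Or.inr ⟨hab, ?_, fun h' => h ⟨h'.1.1, h'.2.1⟩⟩
        have := hsep a b hab
        have := hsep b a hab.symm
        tauto
    · rintro (⟨hab, ⟨ha, hb⟩, hR⟩ | ⟨hab, ⟨ha, hb⟩, hR⟩)
      · exact ⟨hab, ⟨Or.inl ha, Or.inl hb⟩, hR⟩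
      · exact ⟨hab, ⟨Or.inr ha, Or.inr hb⟩, fun h => hR ⟨⟨hRU h.1, ha⟩, ⟨hRU h.2, hb⟩⟩⟩
  -- The second side spends nothing on the common vertices, so the budgets of the first side are
  -- unchanged.
  have hout : ∀ u, u ∈ U₁ → m' u = 0 ∧ edgeDegree M' u = 0 := by
    intro u hu
    by_cases hu' : u ∈ U₂
    · refine k3 u ?_
      have := (hU₁₂ u).1 ⟨hu, hu'⟩
      simpa using this
    · exact ⟨exponent_eq_zero_of_notMem Finset.sdiff_subset hu' k6,
        edgeDegree_eq_zero_of_notMem k1 hu'⟩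
  have hout' : ∀ u, u ∉ U₁ → m u = 0 ∧ edgeDegree M u = 0 := fun u hu =>
    ⟨exponent_eq_zero_of_notMem Finset.sdiff_subset hu h6, edgeDegree_eq_zero_of_notMem h1 hu⟩
  have hdeg : ∀ u, edgeDegree (M ∪ M') u = edgeDegree M u + edgeDegree M' u :=
    edgeDegree_union (hdisj.mono h1 k1)
  refine ⟨M ∪ M', m + m', ?_, ?_, ?_, ?_, ?_, ?_⟩
  · rw [hin]
    exact Finset.union_subset_union h1 k1
  · intro u
    rw [hdeg]
    by_cases hu : u ∈ U₁
    · rw [(hout u hu).2]; exact h2 u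
    · rw [(hout' u hu).2, zero_add]; exact k2 u
  · intro u hu
    rw [hdeg, Finsupp.add_apply, (hout u (hRU hu)).1, (hout u (hRU hu)).2]
    exact h3 u hu
  · intro u hu
    rw [hdeg, Finsupp.add_apply]
    by_cases hu' : u ∈ U₁
    · rw [(hout u hu').1, (hout u hu').2]
      exact h4 u (Finset.mem_inter.2 ⟨hu, hu'⟩)
    · rw [(hout' u hu').1, (hout' u hu').2, zero_add, zero_add]
      by_cases hu2 : u ∈ U₂
      · exact k4 u (Finset.mem_inter.2 ⟨hu, hu2⟩)
      · rw [exponent_eq_zero_of_notMem Finset.sdiff_subset hu2 k6,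
          edgeDegree_eq_zero_of_notMem k1 hu2]
        exact Nat.zero_le _
  · intro u
    rw [Finsupp.add_apply]
    by_cases hu : u ∈ U₁
    · rw [(hout u hu).1]; exact h5 u
    · rw [(hout' u hu).1, zero_add]; exact k5 u
  · have hsd : innerEdges G U R \ (M ∪ M') =
        (innerEdges G U₁ R \ M) ∪ (innerEdges G U₂ {v, z} \ M') := by
      rw [hin]
      ext e
      have : e ∈ innerEdges G U₁ R → e ∉ innerEdges G U₂ {v, z} := fun h => Finset.disjoint_left.1 hdisj h
      have : e ∈ M → _ := fun h => h1 h
      have : e ∈ M' → _ := fun h => k1 h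
      simp only [Finset.mem_sdiff, Finset.mem_union]
      tauto
    rw [hsd, edgePoly_union (hdisj.mono Finset.sdiff_subset Finset.sdiff_subset)]
    refine coeff_mul_edgePoly h6 k6 fun u => ?_
    by_cases hu : u ∈ U₁
    · exact Or.inl (hout u hu).1
    · exact Or.inr fun e he hue => hu (mem_of_mem_innerEdges (Finset.mem_sdiff.1 he).1 hue)

end

open MvPolynomial

/-! ### Deleting a boundary vertex with at most two boundary neighbours -/

section

open scoped Classical

variable {V : Type*} [Fintype V] {G : SimpleGraph V} {κ : V → V → ℤ}

/-- Deletion of a boundary vertex `v` with a neighbor `x` in `R` and at most one other boundary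
neighbor `w`. -/
theorem HasMonomial.of_erase_boundary (hκ : ∀ u v, κ u v ≠ 0) {U B B' R : Finset V} {v x : V}
    (hv : v ∈ U) (hvR : v ∉ R) (hx : x ∈ nbrs G U v) (hxR : x ∈ R) (hRB : R ⊆ B)
    (hB : ∀ u ∈ B, u ≠ v → u ∈ B') (hB' : ∀ u ∈ nbrs G U v, u ∈ B')
    (hw : ∀ w ∈ nbrs G U v, ∀ w' ∈ nbrs G U v, w ∈ B → w' ∈ B → w ≠ x → w' ≠ x → w = w')
    (h : HasMonomial G κ (U.erase v) B' R) : HasMonomial G κ U B R := by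
  obtain ⟨M, m, h1, h2, h3, h4, h5, h6⟩ := h
  set N := nbrs G U v \ B with hNdef
  have hmv : m v = 0 := exponent_eq_zero_of_notMem Finset.sdiff_subset (Finset.notMem_erase v U) h6
  have hMv : edgeDegree M v = 0 := edgeDegree_eq_zero_of_notMem h1 (Finset.notMem_erase v U)
  have hnv : v ∉ nbrs G U v := fun h => (mem_nbrs.1 h).2.ne rfl
  have hvN : v ∉ N := fun h => hnv (Finset.mem_sdiff.1 h).1
  have hNB : ∀ u ∈ N, u ∉ B := fun u hu => (Finset.mem_sdiff.1 hu).2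
  have hN' : ∀ u ∈ N, u ∈ B' := fun u hu => hB' u (Finset.mem_sdiff.1 hu).1
  have hxB := hRB hxR
  have hxN : x ∉ N := fun h => hNB x h hxB
  have hxv : x ≠ v := (mem_nbrs.1 hx).2.ne'
  have hmx : m x = 0 := (h3 x hxR).1
  have hU : innerEdges G U R = innerEdges G (U.erase v) R ∪ starEdges v (nbrs G U v) := by
    have := innerEdges_eq_union_star (G := G) (R := R) (N := nbrs G U v) hv fun u => by
      rw [and_iff_left]
      exact fun h => hvR h.1
    rwa [Finset.erase_eq_of_notMem hvR] at this
  have hMU : M ⊆ innerEdges G U R := hU ▸ h1.trans Finset.subset_union_left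
  have hR' : ∀ u ∈ R, u ≠ v ∧ u ∉ N ∧ m u = 0 ∧ edgeDegree M u = 0 := fun u hu =>
    ⟨fun h => hvR (h ▸ hu), fun h => hNB u h (hRB hu), h3 u hu⟩
  -- The cases in which the matching stays the same: only the exponents of `v` and of its
  -- non-boundary neighbours may change.
  have finish : ∀ n : V →₀ ℕ,
      coeff n (edgePoly κ (innerEdges G (U.erase v) R \ M) * starPoly κ v (nbrs G U v)) ≠ 0 →
      (∀ u, u ≠ v → u ∉ N → n u = m u) → (∀ u ∈ N, n u ≤ 3) → n v ≤ 2 →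
      HasMonomial G κ U B R := by
    intro n hn k1 k2 k3
    refine ⟨M, n, hMU, h2, ?_, ?_, ?_, ?_⟩
    · intro u hu
      obtain ⟨a1, a2, a3, a4⟩ := hR' u hu
      exact ⟨(k1 u a1 a2).trans a3, a4⟩
    · intro u hu
      by_cases huv : u = v
      · subst huv; omega
      · rw [k1 u huv fun h => hNB u h hu]
        exact h4 u (hB u hu huv)
    · intro u
      by_cases huv : u = v
      · subst huv; omega
      · by_cases huN : u ∈ N
        · exact k2 u huN
        · rw [k1 u huv huN]; exact h5 u
    · rwa [hU, union_star_sdiff h1, edgePoly_union_star]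
  by_cases hw0 : ∃ w ∈ nbrs G U v, w ∈ B ∧ w ≠ x
  swap
  · have hn : nbrs G U v = insert x N := by
      ext u
      rw [Finset.mem_insert, hNdef, Finset.mem_sdiff]
      refine ⟨fun h => ?_, ?_⟩
      · by_contra hc
        push Not at hc
        exact hw0 ⟨u, h, hc.2 h, hc.1⟩
      · rintro (rfl | h)
        · exact hx
        · exact h.1
    refine finish (m + ind N + Finsupp.single v 1) ?_ ?_ ?_ ?_
    · rw [hn]
      exact (coeff_mul_starPoly_insert hκ _ hmv hvN hmx hxN hxv).2 h6
    · intro u huv huN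
      simp [ind_apply, huN, huv]
    · intro u hu
      have := h4 u (hN' u hu)
      have huv : u ≠ v := fun h => hvN (h ▸ hu)
      simp only [Finsupp.add_apply, ind_apply, hu, if_true, Finsupp.single_eq_of_ne huv]
      omega
    · simp [ind_apply, hvN, hmv]
  obtain ⟨w, hwn, hwB, hwx⟩ := hw0
  have hwN : w ∉ N := fun h => hNB w h hwB
  have hwv : w ≠ v := (mem_nbrs.1 hwn).2.ne'
  have hn : nbrs G U v = insert x (insert w N) := by
    ext u
    rw [Finset.mem_insert, Finset.mem_insert, hNdef, Finset.mem_sdiff]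
    refine ⟨fun h => ?_, ?_⟩
    · by_contra hc
      push Not at hc
      exact hc.2.1 (hw u h w hwn (hc.2.2 h) hwB hc.1 hwx)
    · rintro (rfl | rfl | h)
      · exact hx
      · exact hwn
      · exact h.1
  have hxwN : x ∉ insert w N := by
    rw [Finset.mem_insert, not_or]
    exact ⟨hwx.symm, hxN⟩
  have hfresh : ∀ n : V →₀ ℕ, n v ≠ 0 →
      coeff n (edgePoly κ (innerEdges G (U.erase v) R \ M)) = 0 := fun n hn =>
    by_contra fun hc => hn (exponent_eq_zero_of_notMem Finset.sdiff_subset (Finset.notMem_erase v U) hc)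
  -- Either `vx` and `vw` are both charged to `v`, or the smaller graph has a monomial with one `w`
  -- traded for `i`. In the second case `vw` is charged to `w`, restoring its exponent, and only
  -- `vi` needs care.
  rcases coeff_mul_starPoly_alternative hκ _ hmv hvN hmx hxwN hxv hwv hwN hfresh h6 with
    hc | ⟨i, hiN, m₀, rfl, hc⟩
  · refine finish (m + ind N + Finsupp.single v 1 + Finsupp.single v 1) ?_ ?_ ?_ ?_
    · rwa [hn]
    · intro u huv huN
      simp [ind_apply, huN, huv]
    · intro u hu
      have := h4 u (hN' u hu)
      have huv : u ≠ v := fun h => hvN (h ▸ hu)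
      simp only [Finsupp.add_apply, ind_apply, hu, if_true, Finsupp.single_eq_of_ne huv]
      omega
    · simp [ind_apply, hvN, hmv]
  have hiv : i ≠ v := fun h => hvN (h ▸ hiN)
  have hix : i ≠ x := fun h => hxN (h ▸ hiN)
  have hiw : i ≠ w := fun h => hwN (h ▸ hiN)
  have hm₀v : m₀ v = 0 := by rw [Finsupp.add_apply] at hmv; omega
  have hm₀x : m₀ x = 0 := by rw [Finsupp.add_apply] at hmx; omega
  have hcv : (m₀ + Finsupp.single i 1 : V →₀ ℕ) v = 0 := by
    rw [Finsupp.add_apply, hm₀v, Finsupp.single_eq_of_ne hiv.symm, zero_add]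
  have hcx : (m₀ + Finsupp.single i 1 : V →₀ ℕ) x = 0 := by
    rw [Finsupp.add_apply, hm₀x, Finsupp.single_eq_of_ne hix.symm, zero_add]
  have hi4 := h4 i (hN' i hiN)
  rw [Finsupp.add_apply, Finsupp.single_eq_of_ne hiw, add_zero] at hi4
  by_cases hiM : edgeDegree M i = 0
  · -- match the edge `vi`
    set N' := insert w (N.erase i) with hN'def
    have hvN' : v ∉ N' := by
      rw [hN'def, Finset.mem_insert, not_or]
      exact ⟨hwv.symm, fun h => hvN (Finset.mem_of_mem_erase h)⟩
    have hxN' : x ∉ N' := by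
      rw [hN'def, Finset.mem_insert, not_or]
      exact ⟨hwx.symm, fun h => hxN (Finset.mem_of_mem_erase h)⟩
    have hviM : s(v, i) ∉ M := fun h => edgeDegree_eq_zero_iff.1 hMv _ h (Sym2.mem_mk_left _ _)
    have hdeg : ∀ u, edgeDegree (insert s(v, i) M) u = edgeDegree M u + if u = v ∨ u = i then 1 else 0 := by
      intro u
      rw [edgeDegree_insert hviM]
      simp only [Sym2.mem_iff]
    have hval : ∀ u, u ≠ v → u ≠ i → u ∉ N →
        (m₀ + Finsupp.single i 1 + ind N' + Finsupp.single v 1 : V →₀ ℕ) u =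
          (m₀ + Finsupp.single w 1 : V →₀ ℕ) u := by
      intro u a1 a2 a3
      simp only [Finsupp.add_apply, ind_apply, hN'def, Finset.mem_insert, Finset.mem_erase, a3,
        and_false, or_false, Finsupp.single_eq_of_ne a1, Finsupp.single_eq_of_ne a2, add_zero,
        Finsupp.single_apply, eq_comm (a := w)]
    refine ⟨insert s(v, i) M, m₀ + Finsupp.single i 1 + ind N' + Finsupp.single v 1, ?_, ?_, ?_, ?_,
      ?_, ?_⟩
    · refine Finset.insert_subset ?_ hMU
      have := (Finset.mem_sdiff.1 hiN).1
      rw [mem_nbrs] at this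
      rw [mk_mem_innerEdges]
      exact ⟨this.2, ⟨hv, this.1⟩, fun h => hvR h.1⟩
    · intro u
      rw [hdeg]
      split_ifs with hu
      · rcases hu with rfl | rfl
        · omega
        · omega
      · exact h2 u
    · intro u hu
      obtain ⟨a1, a2, a3, a4⟩ := hR' u hu
      have a5 : u ≠ i := fun h => a2 (h ▸ hiN)
      rw [hval u a1 a5 a2, hdeg, if_neg (by tauto)]
      exact ⟨a3, a4⟩
    · intro u hu
      have a2 : u ∉ N := fun h => hNB u h hu
      have a5 : u ≠ i := fun h => a2 (h ▸ hiN)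
      rw [hdeg]
      by_cases huv : u = v
      · subst huv
        rw [if_pos (Or.inl rfl)]
        simp only [Finsupp.add_apply, ind_apply, hvN', if_false, hm₀v,
          Finsupp.single_eq_of_ne hiv.symm, Finsupp.single_eq_same]
        omega
      · rw [hval u huv a5 a2, if_neg (by tauto)]
        exact h4 u (hB u hu huv)
    · intro u
      by_cases huv : u = v
      · subst huv
        simp only [Finsupp.add_apply, ind_apply, hvN', if_false, hm₀v,
          Finsupp.single_eq_of_ne hiv.symm, Finsupp.single_eq_same]
        omega
      by_cases hui : u = i
      · subst hui
        have : u ∉ N' := by simp [hN'def, hiw]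
        simp only [Finsupp.add_apply, ind_apply, this, if_false,
          Finsupp.single_eq_of_ne huv, Finsupp.single_eq_same]
        omega
      by_cases huN : u ∈ N
      · have a1 := h4 u (hN' u huN)
        have a2 : u ∈ N' := by simp [hN'def, hui, huN]
        simp only [Finsupp.add_apply, ind_apply, a2, if_true,
          Finsupp.single_eq_of_ne huv, Finsupp.single_eq_of_ne hui] at a1 ⊢
        omega
      · rw [hval u huv hui huN]
        exact h5 u
    · have hsd : innerEdges G U R \ insert s(v, i) M =
          innerEdges G (U.erase v) R \ M ∪ starEdges v (insert x N') := by
        have e1 : insert x N' = (nbrs G U v).erase i := by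
          rw [hn, Finset.erase_insert_of_ne hix.symm, Finset.erase_insert_of_ne hiw.symm]
        have e2 : starEdges v ((nbrs G U v).erase i) = (starEdges v (nbrs G U v)).erase s(v, i) := by
          ext e
          simp only [starEdges, Finset.mem_image, Finset.mem_erase]
          constructor
          · rintro ⟨u, ⟨hu, hu'⟩, rfl⟩
            exact ⟨fun h => hu (Sym2.congr_right.1 h), u, hu', rfl⟩
          · rintro ⟨he, u, hu, rfl⟩
            exact ⟨u, ⟨fun h => he (h ▸ rfl), hu⟩, rfl⟩
        have e3 : s(v, i) ∉ innerEdges G (U.erase v) R := fun h =>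
          Finset.notMem_erase _ _ (mem_of_mem_innerEdges h (Sym2.mem_mk_left _ _))
        rw [Finset.sdiff_insert, hU, union_star_sdiff h1, e1, e2, Finset.erase_union_distrib,
          Finset.erase_eq_of_notMem fun h => e3 (Finset.mem_sdiff.1 h).1]
      rw [hsd, edgePoly_union_star]
      exact (coeff_mul_starPoly_insert hκ _ hcv hvN' hcx hxN' hxv).2 hc
  -- Here `i` is already matched, so its exponent in `m₀` is at most 1: the trade and the edge `vi`
  -- raise it to at most 3.
  · have hvN' : v ∉ insert w N := by
      rw [Finset.mem_insert, not_or]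
      exact ⟨hwv.symm, hvN⟩
    refine finish (m₀ + Finsupp.single i 1 + ind (insert w N) + Finsupp.single v 1) ?_ ?_ ?_ ?_
    · rw [hn]
      exact (coeff_mul_starPoly_insert hκ _ hcv hvN' hcx hxwN hxv).2 hc
    · intro u huv huN
      have a2 : u ≠ i := fun h => huN (h ▸ hiN)
      simp only [Finsupp.add_apply, ind_apply, Finset.mem_insert, huN,
        or_false, Finsupp.single_eq_of_ne huv, Finsupp.single_eq_of_ne a2, add_zero,
        Finsupp.single_apply, eq_comm (a := w)]
    · intro u hu
      have a1 := h4 u (hN' u hu)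
      have huv : u ≠ v := fun h => hvN (h ▸ hu)
      have huw : u ≠ w := fun h => hwN (h ▸ hu)
      simp only [Finsupp.add_apply, ind_apply, Finset.mem_insert_of_mem hu, if_true,
        Finsupp.single_eq_of_ne huv, Finsupp.single_eq_of_ne huw] at a1 ⊢
      by_cases hui : u = i
      · subst hui
        rw [Finsupp.single_eq_same]
        omega
      · rw [Finsupp.single_eq_of_ne hui]
        omega
    · simp only [Finsupp.add_apply, ind_apply, hvN', if_false, hm₀v,
        Finsupp.single_eq_of_ne hiv.symm, Finsupp.single_eq_same]
      omega

end

/-! ### The Thomassen-type induction -/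

section

open scoped Classical

variable {V : Type*} [Fintype V] {G : SimpleGraph V} {κ : V → V → ℤ}

open SimpleGraph in
/-- The induction of Thomassen type. The set `S` stands for the outer face, and `B` for the
vertices on the boundary. -/
theorem hasMonomial_of_noK5_of_noK33 (hκ : ∀ u v, κ u v ≠ 0) (h5 : G.NoK5) (h33 : G.NoK33)
    (U : Finset V) : ∀ (B R : Finset V) (S : Set V), G.IsConnSet S → (∀ u ∈ S, u ∉ U) → B ⊆ U →
      (∀ b ∈ B, G.Touch S {b}) → R ⊆ B →
      (R = ∅ ∨ (∃ x, R = {x}) ∨ ∃ x y, G.Adj x y ∧ R = {x, y}) → HasMonomial G κ U B R := by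
  induction U using Finset.strongInduction with
  | H U IH =>
  intro B R S hS hSU hBU hSB hRB hR
  -- A deleted boundary vertex joins `S`, which stays connected, and its neighbours become boundary
  -- vertices.
  have hstep : ∀ v ∈ B, ∀ R' ⊆ B.erase v,
      (R' = ∅ ∨ (∃ x, R' = {x}) ∨ ∃ x y, G.Adj x y ∧ R' = {x, y}) →
      HasMonomial G κ (U.erase v) (B.erase v ∪ nbrs G U v) R' := by
    intro v hv R' hR' hR''
    obtain ⟨u, hu, v', rfl, huv⟩ := hSB v hv
    refine IH _ (Finset.erase_ssubset (hBU hv)) _ _ (insert v' S) (hS.insert hu huv.symm) ?_ ?_ ?_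
      (hR'.trans Finset.subset_union_left) hR''
    · rintro a (rfl | ha) h
      · exact Finset.notMem_erase _ _ h
      · exact hSU a ha (Finset.mem_of_mem_erase h)
    · refine Finset.union_subset (Finset.erase_subset_erase _ hBU) fun a ha => ?_
      rw [mem_nbrs] at ha
      exact Finset.mem_erase.2 ⟨ha.2.ne', ha.1⟩
    · intro b hb
      rcases Finset.mem_union.1 hb with hb | hb
      · obtain ⟨s, hs, b', rfl, h⟩ := hSB b (Finset.mem_of_mem_erase hb)
        exact ⟨s, Or.inr hs, b', rfl, h⟩
      · exact ⟨v', Or.inl rfl, b, rfl, (mem_nbrs.1 hb).2⟩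
  have hpair : ∀ x y, x ∈ B → y ∈ B → G.Adj x y → HasMonomial G κ U B {x, y} := by
    intro x y hx hy hxy
    have hxyB : ({x, y} : Finset V) ⊆ B := by
      intro u hu
      rw [Finset.mem_insert, Finset.mem_singleton] at hu
      rcases hu with rfl | rfl <;> assumption
    have hclique : ({x, y} : Finset V) = ∅ ∨ (∃ a, ({x, y} : Finset V) = {a}) ∨
        ∃ a b, G.Adj a b ∧ ({x, y} : Finset V) = {a, b} := Or.inr (Or.inr ⟨x, y, hxy, rfl⟩)
    by_cases hv : ∃ v ∈ B, v ≠ y ∧ G.Adj x v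
    swap
    · push Not at hv
      have he : ({x, y} : Finset V).erase x = {y} := by
        rw [Finset.erase_insert]
        rw [Finset.mem_singleton]
        exact hxy.ne
      refine HasMonomial.of_erase hκ (hBU hx) (Or.inl (Finset.mem_insert_self _ _))
        (B' := B.erase x ∪ nbrs G U x) ?_ ?_ ?_ ?_
      · exact fun u hu hux => Finset.mem_union_left _ (Finset.mem_erase.2 ⟨hux, hu⟩)
      · exact fun u hu => Finset.mem_union_right _ hu
      · intro u hu huB
        by_contra hc
        rw [Finset.mem_insert, Finset.mem_singleton, not_or] at hc
        exact hv u huB hc.2 (mem_nbrs.1 hu).2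
      · rw [he]
        refine hstep x hx _ ?_ (Or.inr (Or.inl ⟨y, rfl⟩))
        rw [Finset.singleton_subset_iff]
        exact Finset.mem_erase.2 ⟨hxy.ne', hy⟩
    obtain ⟨v, hvB, hvy, hxv⟩ := hv
    have hvR : v ∉ ({x, y} : Finset V) := by
      rw [Finset.mem_insert, Finset.mem_singleton, not_or]
      exact ⟨hxv.ne', hvy⟩
    by_cases hw : ∀ w ∈ nbrs G U v, ∀ w' ∈ nbrs G U v, w ∈ B → w' ∈ B → w ≠ x → w' ≠ x → w = w'
    · refine HasMonomial.of_erase_boundary hκ (hBU hvB) hvR (mem_nbrs.2 ⟨hBU hx, hxv.symm⟩)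
        (Finset.mem_insert_self _ _) hxyB (B' := B.erase v ∪ nbrs G U v) ?_ ?_ hw ?_
      · exact fun u hu hux => Finset.mem_union_left _ (Finset.mem_erase.2 ⟨hux, hu⟩)
      · exact fun u hu => Finset.mem_union_right _ hu
      · refine hstep v hvB _ (fun u hu => ?_) hclique
        exact Finset.mem_erase.2 ⟨fun h => hvR (h ▸ hu), hxyB hu⟩
    -- a separating chord
    push Not at hw
    obtain ⟨w, hwn, w', hwn', hwB, hwB', hwx, hwx', hww'⟩ := hw
    rw [mem_nbrs] at hwn hwn'
    have hchord : ∀ z p q, z ∈ B → G.Adj v z → p ∈ U ∧ p ≠ v ∧ p ≠ z → q ∈ U ∧ q ≠ v ∧ q ≠ z →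
        ¬ G.ConnIn (((U : Set V) \ {v}) \ {z}) p q → HasMonomial G κ U B {x, y} := by
      intro z p q hz hvz hp hq hpq
      -- An end `r` of the edge `xy` other than `z`: its component `C` after removal of `v` and `z`,
      -- together with these two, contains the whole edge.
      obtain ⟨r, hr, hrR, hrz, hrxy⟩ : ∃ r, r ∈ U ∧ r ∈ ({x, y} : Finset V) ∧ r ≠ z ∧
          ∀ u ∈ ({x, y} : Finset V), u = z ∨ u = r ∨ G.Adj r u := by
        by_cases hxz : x = z
        · refine ⟨y, hBU hy, by simp, fun h => hxy.ne (hxz.trans h.symm), ?_⟩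
          intro u hu
          rw [Finset.mem_insert, Finset.mem_singleton] at hu
          rcases hu with rfl | rfl
          · exact Or.inl hxz
          · exact Or.inr (Or.inl rfl)
        · refine ⟨x, hBU hx, by simp, hxz, ?_⟩
          intro u hu
          rw [Finset.mem_insert, Finset.mem_singleton] at hu
          rcases hu with rfl | rfl
          · exact Or.inr (Or.inl rfl)
          · exact Or.inr (Or.inr hxy)
      have hrv : r ≠ v := fun h => hvR (h ▸ hrR)
      set A : Set V := ((U : Set V) \ {v}) \ {z} with hA
      have hrA : r ∈ A := ⟨⟨hr, hrv⟩, hrz⟩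
      set C : Finset V := U.filter fun u => G.ConnIn A r u with hC
      have hCA : ∀ u ∈ C, u ∈ A := fun u hu => ConnIn.mem (Finset.mem_filter.1 hu).2 hrA
      have hvC : v ∉ C := fun h => (hCA v h).1.2 rfl
      have hzC : z ∉ C := fun h => (hCA z h).2 rfl
      have hrC : r ∈ C := Finset.mem_filter.2 ⟨hr, Relation.ReflTransGen.refl⟩
      have hadj : ∀ a b, a ∈ C → b ∈ U → b ≠ v → b ≠ z → G.Adj a b → b ∈ C := by
        intro a b ha hb hbv hbz hab
        refine Finset.mem_filter.2 ⟨hb, (Finset.mem_filter.1 ha).2.tail ⟨hab, hCA a ha, ?_⟩⟩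
        exact ⟨⟨hb, hbv⟩, hbz⟩
      have hvU := hBU hvB
      have hzU := hBU hz
      have hCU : C ⊆ U := Finset.filter_subset _ _
      set U₁ : Finset V := insert v (insert z C) with hU₁
      set U₂ : Finset V := U \ C with hU₂
      have hm₁ : ∀ u, u ∈ U₁ ↔ u = v ∨ u = z ∨ u ∈ C := fun u => by
        rw [hU₁, Finset.mem_insert, Finset.mem_insert]
      have hm₂ : ∀ u, u ∈ U₂ ↔ u ∈ U ∧ u ∉ C := fun u => Finset.mem_sdiff
      have hU₁U : U₁ ⊆ U := by
        intro u hu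
        rcases (hm₁ u).1 hu with rfl | rfl | h
        · exact hvU
        · exact hzU
        · exact hCU h
      have hRU₁ : ({x, y} : Finset V) ⊆ U₁ := by
        intro u hu
        rw [hm₁]
        rcases hrxy u hu with h | h | h
        · exact Or.inr (Or.inl h)
        · exact Or.inr (Or.inr (h ▸ hrC))
        · by_cases huz : u = z
          · exact Or.inr (Or.inl huz)
          · exact Or.inr (Or.inr (hadj r u hrC (hBU (hxyB hu)) (fun h => hvR (h ▸ hu)) huz h))
      have hIH : ∀ U' ⊂ U, ∀ R' ⊆ B ∩ U',
          (R' = ∅ ∨ (∃ x, R' = {x}) ∨ ∃ x y, G.Adj x y ∧ R' = {x, y}) →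
          HasMonomial G κ U' (B ∩ U') R' := by
        intro U' hU' R' hR' hR''
        exact IH U' hU' _ _ S hS (fun u hu h => hSU u hu (hU'.1 h)) Finset.inter_subset_right
          (fun b hb => hSB b (Finset.mem_inter.1 hb).1) hR' hR''
      refine HasMonomial.glue (U₁ := U₁) (U₂ := U₂) (v := v) (z := z) ?_ ?_ hRU₁ ?_ ?_ ?_
      · ext u
        rw [Finset.mem_union, hm₂]
        refine ⟨fun hu => ?_, fun hu => hu.elim (fun h => hU₁U h) And.left⟩
        by_cases h : u ∈ C
        · exact Or.inl ((hm₁ u).2 (Or.inr (Or.inr h)))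
        · exact Or.inr ⟨hu, h⟩
      · intro u
        rw [hm₁, hm₂]
        constructor
        · rintro ⟨h | h | h, -, h'⟩
          · exact Or.inl h
          · exact Or.inr h
          · exact absurd h h'
        · rintro (rfl | rfl)
          · exact ⟨Or.inl rfl, hvU, hvC⟩
          · exact ⟨Or.inr (Or.inl rfl), hzU, hzC⟩
      · intro a b hab ha hb
        rw [hm₂] at hb ⊢
        rw [hm₁] at ha ⊢
        rcases ha with rfl | rfl | ha
        · exact Or.inl ⟨hvU, hvC⟩
        · exact Or.inl ⟨hzU, hzC⟩
        · by_cases hbv : b = v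
          · exact Or.inr (Or.inl hbv)
          by_cases hbz : b = z
          · exact Or.inr (Or.inr (Or.inl hbz))
          exact absurd (hadj a b ha hb.1 hbv hbz hab) hb.2
      · refine hIH U₁ ⟨hU₁U, fun h => hpq ?_⟩ _ (Finset.subset_inter hxyB hRU₁) hclique
        have hmem : ∀ u, u ∈ U ∧ u ≠ v ∧ u ≠ z → G.ConnIn A r u := by
          intro u hu
          rcases (hm₁ u).1 (h hu.1) with h | h | h
          · exact absurd h hu.2.1
          · exact absurd h hu.2.2
          · exact (Finset.mem_filter.1 h).2
        exact (hmem p hp).symm.trans (hmem q hq)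
      -- The side without `r` uses the chord `vz` as its precoloured edge; the set `S` serves both
      -- sides.
      · refine hIH U₂ ⟨Finset.sdiff_subset, fun h => ((hm₂ r).1 (h hr)).2 hrC⟩ _ ?_
          (Or.inr (Or.inr ⟨v, z, hvz, rfl⟩))
        intro u hu
        rw [Finset.mem_insert, Finset.mem_singleton] at hu
        rw [Finset.mem_inter, hm₂]
        rcases hu with rfl | rfl
        · exact ⟨hvB, hvU, hvC⟩
        · exact ⟨hz, hzU, hzC⟩
    -- If none of `w'`, `w`, `x` gave a separating chord with `v`, all three connections needed for
    -- the forbidden minors would exist.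
    by_contra hno
    refine exists_separator h5 h33 (S := S) (A := (U : Set V) \ {v}) (v := v) (x := x) (w := w)
      (w' := w') hS (fun u hu h => hSU u hu h.1) (fun h => h.2 rfl) (fun h => hSU v h (hBU hvB))
      ⟨hBU hx, hxv.ne⟩ ⟨hwn.1, hwn.2.ne'⟩ ⟨hwn'.1, hwn'.2.ne'⟩ hwx.symm hwx'.symm hww' hxv.symm hwn.2
      hwn'.2 (hSB v hvB) (hSB x hx) (hSB w hwB) (hSB w' hwB') ?_ ?_ ?_
    · exact by_contra fun h => hno (hchord w' _ _ hwB' hwn'.2 ⟨hBU hx, hxv.ne, hwx'.symm⟩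
        ⟨hwn.1, hwn.2.ne', hww'⟩ h)
    · exact by_contra fun h => hno (hchord w _ _ hwB hwn.2 ⟨hwn'.1, hwn'.2.ne', hww'.symm⟩
        ⟨hBU hx, hxv.ne, hwx.symm⟩ h)
    · exact by_contra fun h => hno (hchord x _ _ hx hxv.symm ⟨hwn'.1, hwn'.2.ne', hwx'⟩
        ⟨hwn.1, hwn.2.ne', hwx⟩ h)
  have hsingle : ∀ x ∈ B, HasMonomial G κ U B {x} := by
    intro x hx
    by_cases hy : ∃ y ∈ B, G.Adj x y
    · obtain ⟨y, hy, hxy⟩ := hy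
      exact (hpair x y hx hy hxy).of_pair hκ (hBU hx) (hBU hy) hxy
    · push Not at hy
      refine HasMonomial.of_erase hκ (hBU hx) (Or.inl (Finset.mem_singleton_self _))
        (B' := B.erase x ∪ nbrs G U x) ?_ ?_ ?_ ?_
      · exact fun u hu hux => Finset.mem_union_left _ (Finset.mem_erase.2 ⟨hux, hu⟩)
      · exact fun u hu => Finset.mem_union_right _ hu
      · exact fun u hu huB => absurd (mem_nbrs.1 hu).2 (hy u huB)
      · refine hstep x hx _ ?_ (Or.inl ?_)
        · rw [Finset.erase_singleton]; exact Finset.empty_subset _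
        · exact Finset.erase_singleton _
  rcases hR with rfl | ⟨x, rfl⟩ | ⟨x, y, hxy, rfl⟩
  · rcases B.eq_empty_or_nonempty with rfl | ⟨x, hx⟩
    · rcases U.eq_empty_or_nonempty with rfl | ⟨v, hv⟩
      · exact HasMonomial.empty
      -- With an empty boundary any vertex can be deleted, and it alone becomes the new outer set.
      · refine HasMonomial.of_erase hκ hv (Or.inr rfl) (B' := nbrs G U v) (by simp)
          (fun u hu => hu) (by simp) ?_
        refine IH _ (Finset.erase_ssubset hv) _ _ {v} (isConnSet_singleton v) ?_ ?_ ?_ (by simp)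
          (Or.inl (by simp))
        · rintro _ rfl
          exact Finset.notMem_erase _ _
        · intro a ha
          rw [mem_nbrs] at ha
          exact Finset.mem_erase.2 ⟨ha.2.ne', ha.1⟩
        · exact fun b hb => ⟨v, rfl, b, rfl, (mem_nbrs.1 hb).2⟩
    · exact (hsingle x hx).of_singleton
  · exact hsingle x (hRB (Finset.mem_singleton_self x))
  · exact hpair x y (hRB (by simp)) (hRB (by simp)) hxy

end

/-! ### Signed colourings and the Nullstellensatz -/

section

open scoped Classical

open MvPolynomial

variable {V : Type*} [Fintype V]

/-- The sign of an edge, and `1` for other pairs of vertices. -/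
noncomputable def SignedGraph.edgeSign {V : Type*} (S : SignedGraph V) (e : Sym2 V) : ℤˣ :=
  if h : e ∈ S.graph.edgeSet then S.sign ⟨e, h⟩ else 1

/-- The coefficients of the graph polynomial of a signed graph. -/
noncomputable def SignedGraph.edgeCoeff (S : SignedGraph V) (u v : V) : ℤ :=
  if Fintype.equivFin V u < Fintype.equivFin V v then 1 else -(S.edgeSign s(u, v) : ℤ)

theorem SignedGraph.edgeCoeff_ne_zero (S : SignedGraph V) (u v : V) : S.edgeCoeff u v ≠ 0 := by
  rw [edgeCoeff]
  split_ifs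
  · exact one_ne_zero
  · exact neg_ne_zero.2 (Units.ne_zero _)

/-- The numbering of the vertices only decides which end gets coefficient 1. In the reversed case
the form vanishes because the square of a sign is 1. -/
theorem SignedGraph.eval_edgeForm_eq_zero (S : SignedGraph V) {c : V → ℤ} {u v : V} (huv : u ≠ v)
    (h : c u = (S.edgeSign s(u, v) : ℤ) * c v) : eval c (edgeForm S.edgeCoeff s(u, v)) = 0 := by
  have hne : Fintype.equivFin V u ≠ Fintype.equivFin V v := fun h => huv (Equiv.injective _ h)
  have hsq : (S.edgeSign s(u, v) : ℤ) * (S.edgeSign s(u, v) : ℤ) = 1 := by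
    rw [← Units.val_mul, Int.units_mul_self, Units.val_one]
  rw [edgeForm_mk]
  simp only [map_add, map_mul, eval_C, eval_X, edgeCoeff]
  rw [Sym2.eq_swap (a := v) (b := u), h]
  rcases lt_or_gt_of_ne hne with h1 | h1
  · rw [if_pos h1, if_neg h1.asymm]
    ring
  · rw [if_neg h1.asymm, if_pos h1, neg_mul, ← mul_assoc, hsq]
    ring

end

theorem mainTheorem8 {V : Type*} [Finite V] (S : SignedGraph V) (hS : S.IsPlanar) :
    S.IsDefectiveChoosable 1 4 := by
  classical
  intro L hL
  have : Fintype V := Fintype.ofFinite V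
  obtain ⟨R, hR⟩ := hS
  obtain ⟨M, m, hMU, hM, -, -, hm, hcoeff⟩ := hasMonomial_of_noK5_of_noK33 S.edgeCoeff_ne_zero
    hR.noK5 hR.noK33 Finset.univ ∅ ∅ ∅ (fun _ h => absurd h (Set.notMem_empty _))
    (fun _ h => absurd h (Set.notMem_empty _)) (Finset.empty_subset _) (by simp) subset_rfl
    (Or.inl rfl)
  -- The polynomial is homogeneous, so the monomial found has top degree; exponents at most 3 are
  -- below the list sizes.
  obtain ⟨c, hcL, hc⟩ := MvPolynomial.combinatorial_nullstellensatz_exists_eval_nonzero _ m hcoeff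
    (((isHomogeneous_edgePoly _).totalDegree (fun h => hcoeff (by rw [h, MvPolynomial.coeff_zero]))).trans
      (degree_eq_of_coeff_edgePoly_ne_zero hcoeff).symm) L
    fun v => lt_of_lt_of_le (Nat.lt_succ_of_le (hm v)) (hL v)
  refine ⟨c, hcL, fun v => ?_⟩
  -- A violated edge outside `M` would be a zero factor of the nonzero product.
  have hviol : ∀ u ∈ S.violations c v, s(u, v) ∈ M := by
    rintro u ⟨huv, h⟩
    by_contra hM
    rw [edgePoly, map_prod, Finset.prod_ne_zero_iff] at hc
    refine hc s(u, v) (Finset.mem_sdiff.2 ⟨?_, hM⟩) (S.eval_edgeForm_eq_zero huv.ne ?_)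
    · rw [mk_mem_innerEdges]
      simp [huv]
    · rw [h, SignedGraph.edgeSign, dif_pos]
  calc (S.violations c v).ncard
      = ((fun u => s(u, v)) '' S.violations c v).ncard :=
        (Set.ncard_image_of_injective _ fun _ _ h => Sym2.congr_left.1 h).symm
    _ ≤ ((M.filter fun e => v ∈ e : Finset (Sym2 V)) : Set (Sym2 V)).ncard := by
        refine Set.ncard_le_ncard ?_ (Finset.finite_toSet _)
        rintro _ ⟨u, hu, rfl⟩
        exact Finset.mem_coe.2 (Finset.mem_filter.2 ⟨hviol u hu, Sym2.mem_mk_right _ _⟩)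
    _ ≤ 1 := by
        rw [Set.ncard_coe_finset]
        refine le_trans (le_of_eq ?_) (hM v)
        rw [edgeDegree]
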